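/- **Theorem.** Let $R$ be a commutative $\mathbb{Q}$-algebra, $s,t\in R$, $\alpha=s+t$, $\beta=st$. Let $f(x)=\sum_{n\ge 1}E_n(s,t)\frac{x^n}{n!}\in R[[x]]$, where $E_n(s,t)=\sum_{\sigma\in\mathfrak S_n}s^{r(\sigma)}t^{d(\sigma)}$ is the homogeneous Eulerian polynomial, $r(\sigma)$ and $d(\sigma)$ being the numbers of rises ($\sigma(i)<\sigma(i+1)$) and descents ($\sigma(i)>\sigma(i+1)$) of $\sigma$. Then $$f(x)\,\bigl(se^{tx}-te^{sx}\bigr)=e^{sx}-e^{tx},$$ that is, $f(x)=\frac{e^{sx}-e^{tx}}{se^{tx}-te^{sx}}$ whenever $s-t$ is not a zero divisor. Let $\mathbf{Sym}=R\langle S_1,S_2,\dots\rangle$ be the free associative algebra of noncommutative symmetric functions, graded by $\deg S_n=n$, let $S_0=1$, $\sigma_1=\sum_{n\ge 0}S_n$ and $\varphi=\log\sigma_1$ (in the completion with respect to the degree), let $Y=f(\varphi)=\sum_{n\ge 1}Y_n$ with $Y_n$ homogeneous of degree $n$, and put $Y^I=Y_{i_1}\cdots Y_{i_r}$ and $S^I=S_{i_1}\cdots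 S_{i_r}$ for each composition $I=(i_1,\dots,i_r)$ (a word of positive integers, possibly empty). Let $QSym$ be the algebra of quasi-symmetric functions over $R$, paired with $\mathbf{Sym}$ by $\langle M_I,S^J\rangle=\delta_{I,J}$, where $M_I$ are the monomial quasi-symmetric functions. For $\alpha,\beta\in R$ define the bilinear operation $\star$ on the free $R$-module on words of positive integers by $\epsilon\star w=w\star\epsilon=w$ for the empty word $\epsilon$ and, for letters $a,b$ and words $u,v$, $$au\star bv=a(u\star bv)+b(au\star v)+\alpha\,[a+b]\,(u\star v)+\beta\,\zeta_{a+b}(u\star v),$$ where $[a+b]$ is the letter equal to the sum $a+b$, prepended to each word, and $\zeta_x$ is the linear map with $\zeta_x(bw)=[b+x]\,w$ and $\zeta_x(\epsilon)=0$. 1. The $Y^I$ form a basis of $\mathbf{Sym}$. There is a unique family $(X_I)$ in $QSym$ with $\langle X_I,Y^J\rangle=\delta_{I,J}$ for all compositions $I,J$, and it is a basis of $QSym$. 2. With $\alpha=s+t$ and $\beta=st$, one has $X_IX_J=X(I\star J)$ for all compositions $I,J$, where $X$ is the linear map from linear combinations of words to $QSym$ sending each word $I$ to $X_I$. 3. For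 these $\alpha,\beta$ the operation $\star$ is commutative and associative. 4. Special cases: for $s=t=0$ one has $f(x)=x$, and $\star$ is the ordinary shuffle, $au \sqcup\!\sqcup bv=a(u \sqcup\!\sqcup bv)+b(au \sqcup\!\sqcup v)$; for $(s,t)=(1,0)$ one has $f(x)=e^x-1$, and $\star$ is the quasi-shuffle, $au*bv=a(u*bv)+b(au*v)+[a+b](u*v)$; for $(s,t)=(1,-1)$ one has $f(x)=\tanh x=\frac{e^x-e^{-x}}{e^x+e^{-x}}$, and $\star$ is the block shuffle of Hirose–Sato and Keilthy, $au\diamond bv=a(u\diamond bv)+b(au\diamond v)-\zeta_{a+b}(u\diamond v)$. In each case the empty word is the unit. -/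

import Mathlib

namespace EulerianQSym

noncomputable section

open Finset

/-! ### Homogeneous Eulerian polynomials -/

/-- The number of descents of a permutation `σ` of `{0, …, n - 1}`, i.e. of positions `i` such that
`i + 1` is again a position and `σ (i + 1) < σ i`. -/
def descents {n : ℕ} (σ : Equiv.Perm (Fin n)) : ℕ :=
  Fintype.card {i : Fin n // ∃ h : (i : ℕ) + 1 < n, σ ⟨(i : ℕ) + 1, h⟩ < σ i}

/-- The number of rises of a permutation `σ` of `{0, …, n - 1}`, i.e. of positions `i` such that
`i + 1` is again a position and `σ i < σ (i + 1)`. -/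
def rises {n : ℕ} (σ : Equiv.Perm (Fin n)) : ℕ :=
  Fintype.card {i : Fin n // ∃ h : (i : ℕ) + 1 < n, σ i < σ ⟨(i : ℕ) + 1, h⟩}

/-- The homogeneous Eulerian polynomial `E_n(s, t) = ∑_σ s ^ rises σ * t ^ descents σ`. -/
def eulerian {R : Type*} [CommRing R] (s t : R) (n : ℕ) : R :=
  ∑ σ : Equiv.Perm (Fin n), s ^ rises σ * t ^ descents σ

/-- The exponential generating function `f(x) = ∑_{n ≥ 1} E_n(s, t) x ^ n / n!`. -/
def eulerianSeries {R : Type*} [CommRing R] [Algebra ℚ R] (s t : R) : PowerSeries R :=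
  PowerSeries.mk fun n =>
    if n = 0 then 0 else algebraMap ℚ R (1 / (n.factorial : ℚ)) * eulerian s t n

/-! ### Noncommutative symmetric functions -/

/-- Noncommutative symmetric functions: the free associative algebra on `S_1, S_2, …`. -/
abbrev NSym (R : Type*) [CommRing R] : Type _ := FreeAlgebra R ℕ+

/-- The complete functions `S_n`, with `S_0 = 1`. -/
def complete (R : Type*) [CommRing R] (n : ℕ) : NSym R :=
  if h : 0 < n then FreeAlgebra.ι R (⟨n, h⟩ : ℕ+) else 1

/-- `σ_z = ∑_{n ≥ 0} S_n z ^ n`. An infinite sum of homogeneous noncommutative symmetric functions,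
one of each degree `n`, is written as the power series in a central variable `z` whose `n`-th
coefficient is the component of degree `n`. -/
def sigma (R : Type*) [CommRing R] : PowerSeries (NSym R) :=
  PowerSeries.mk (complete R)

/-- Substitution `g(u) = ∑_k g_k u ^ k` of a power series `u` without constant term, whose
coefficients lie in a possibly noncommutative algebra `A`, into a power series `g` with scalar
coefficients. As `u ^ k` is divisible by `z ^ k`, only `k ≤ n` contributes to the coefficient
of `z ^ n`. -/
def compose {R A : Type*} [CommRing R] [Ring A] [Algebra R A]
    (g : PowerSeries R) (u : PowerSeries A) : PowerSeries A :=
  PowerSeries.mk fun n =>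
    ∑ k ∈ range (n + 1), PowerSeries.coeff k g • PowerSeries.coeff n (u ^ k)

/-- `φ = log σ`. Here `PowerSeries.log R` is the series `log (1 + x)`. -/
def phi (R : Type*) [CommRing R] [Algebra ℚ R] : PowerSeries (NSym R) :=
  compose (PowerSeries.log R) (sigma R - 1)

/-- `Y_n`, the component of degree `n` of `Y = f(φ)`, for `f = eulerianSeries s t`. -/
def yGen {R : Type*} [CommRing R] [Algebra ℚ R] (s t : R) (n : ℕ) : NSym R :=
  PowerSeries.coeff n (compose (eulerianSeries s t) (phi R))

/-- `Y^I = Y_{i_1} ⋯ Y_{i_r}` for a composition (word of positive integers) `I = (i_1, …, i_r)`. -/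
def yMul {R : Type*} [CommRing R] [Algebra ℚ R] (s t : R) (I : List ℕ+) : NSym R :=
  (I.map fun i => yGen s t (i : ℕ)).prod

/-! ### Quasi-symmetric functions -/

/-- A power series in commuting variables `x_0, x_1, …` is quasi-symmetric if its coefficients are
unchanged when the indices of the variables in a monomial are moved by a strictly increasing map.
(Equivalently, `x_{j_1} ^ {i_1} ⋯ x_{j_r} ^ {i_r}` with `j_1 < ⋯ < j_r` has a coefficient which
depends on `(i_1, …, i_r)` only.) -/
def IsQuasiSymmetric {R : Type*} [CommRing R] (F : MvPowerSeries ℕ R) : Prop :=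
  ∀ (g : ℕ ↪o ℕ) (m : ℕ →₀ ℕ),
    MvPowerSeries.coeff (m.embDomain g.toEmbedding) F = MvPowerSeries.coeff m F

/-- A power series of bounded degree. -/
def HasBoundedDegree {R : Type*} [CommRing R] (F : MvPowerSeries ℕ R) : Prop :=
  ∃ d : ℕ, ∀ m : ℕ →₀ ℕ, d < m.degree → MvPowerSeries.coeff m F = 0

theorem IsQuasiSymmetric.mul {R : Type*} [CommRing R] {F G : MvPowerSeries ℕ R}
    (hF : IsQuasiSymmetric F) (hG : IsQuasiSymmetric G) : IsQuasiSymmetric (F * G) := by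
  intro g m
  classical
  rw [MvPowerSeries.coeff_mul, MvPowerSeries.coeff_mul,
    ← Finsupp.image_prodMap_embDomain_antidiagonal, Finset.sum_image]
  · exact Finset.sum_congr rfl fun p _ => by
      simp only [Prod.map_fst, Prod.map_snd, hF g p.1, hG g p.2]
  · intro p _ q _ h
    exact ((Finsupp.embDomain_injective _).prodMap (Finsupp.embDomain_injective _)) h

theorem HasBoundedDegree.mul {R : Type*} [CommRing R] {F G : MvPowerSeries ℕ R}
    (hF : HasBoundedDegree F) (hG : HasBoundedDegree G) : HasBoundedDegree (F * G) := by
  classical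
  obtain ⟨d, hd⟩ := hF
  obtain ⟨e, he⟩ := hG
  refine ⟨d + e, fun m hm => ?_⟩
  rw [MvPowerSeries.coeff_mul]
  refine Finset.sum_eq_zero fun p hp => ?_
  rw [Finset.HasAntidiagonal.mem_antidiagonal] at hp
  have h : p.1.degree + p.2.degree = m.degree := by rw [← hp, map_add]
  rcases Nat.lt_or_ge d p.1.degree with h1 | h1
  · rw [hd _ h1, zero_mul]
  · rw [he _ (by omega), mul_zero]

theorem isQuasiSymmetric_C {R : Type*} [CommRing R] (r : R) :
    IsQuasiSymmetric (MvPowerSeries.C (σ := ℕ) r) := by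
  classical
  intro g m
  rw [MvPowerSeries.coeff_C, MvPowerSeries.coeff_C]
  have h : m.embDomain g.toEmbedding = 0 ↔ m = 0 := Finsupp.embDomain_eq_zero
  simp only [h]

theorem hasBoundedDegree_C {R : Type*} [CommRing R] (r : R) :
    HasBoundedDegree (MvPowerSeries.C (σ := ℕ) r) := by
  classical
  refine ⟨0, fun m hm => ?_⟩
  rw [MvPowerSeries.coeff_C, if_neg]
  rintro rfl
  simp at hm

/-- The algebra of quasi-symmetric functions over `R`: the quasi-symmetric power series of bounded
degree in the variables `x_0, x_1, …`. -/
def QSym (R : Type*) [CommRing R] : Subalgebra R (MvPowerSeries ℕ R) where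
  carrier := {F | IsQuasiSymmetric F ∧ HasBoundedDegree F}
  mul_mem' := fun hF hG => ⟨hF.1.mul hG.1, hF.2.mul hG.2⟩
  add_mem' := by
    rintro F G ⟨hF, d, hd⟩ ⟨hG, e, he⟩
    refine ⟨fun g m => by rw [map_add, map_add, hF g m, hG g m], max d e, fun m hm => ?_⟩
    rw [map_add, hd m (lt_of_le_of_lt (le_max_left _ _) hm),
      he m (lt_of_le_of_lt (le_max_right _ _) hm), add_zero]
  algebraMap_mem' := fun r => ⟨isQuasiSymmetric_C r, hasBoundedDegree_C r⟩

/-- The exponent of the monomial `x_0 ^ {i_1} x_1 ^ {i_2} ⋯ x_{r-1} ^ {i_r}` of a composition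
`I = (i_1, …, i_r)`. -/
def exponent (I : List ℕ+) : ℕ →₀ ℕ :=
  (I.map fun i => (i : ℕ)).toFinsupp

/-- The canonical pairing `⟨F, P⟩` between `QSym` and noncommutative symmetric functions, for which
the monomial basis `M_I` of `QSym` is dual to the basis `S^I = S_{i_1} ⋯ S_{i_r}`. It is the linear
extension in `P` of `⟨F, S^I⟩ =` the coefficient of `M_I` in `F`, which is the coefficient of
`x_0 ^ {i_1} ⋯ x_{r-1} ^ {i_r}` in the series `F`. -/
def pairing {R : Type*} [CommRing R] (F : QSym R) : NSym R →ₗ[R] R :=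
  (FreeAlgebra.basisFreeMonoid R ℕ+).constr R fun I =>
    MvPowerSeries.coeff (exponent (FreeMonoid.toList I)) (F : MvPowerSeries ℕ R)

/-- `X_I` is the family in `QSym` dual to the family `Y^I`: `⟨X_I, Y^J⟩ = δ_{I,J}`. -/
def IsDualFamily {R : Type*} [CommRing R] (X : List ℕ+ → QSym R) (Y : List ℕ+ → NSym R) : Prop :=
  ∀ I J : List ℕ+, pairing (X I) (Y J) = if I = J then 1 else 0

/-! ### Shuffle-like products of words of positive integers -/

/-- Formal linear combinations of words of positive integers. -/
abbrev Words (R : Type*) [CommRing R] : Type _ := List ℕ+ →₀ R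

/-- `w ↦ a w`, extended linearly. -/
def prepend {R : Type*} [CommRing R] (a : ℕ+) : Words R →ₗ[R] Words R :=
  Finsupp.linearCombination R fun w => Finsupp.single (a :: w) 1

/-- `ζ_x(b w) = (b + x) w` on nonempty words, `ζ_x(ε) = 0` on the empty word, extended linearly. -/
def zeta {R : Type*} [CommRing R] (x : ℕ+) : Words R →ₗ[R] Words R :=
  Finsupp.linearCombination R fun w =>
    match w with
    | [] => 0
    | b :: v => Finsupp.single ((b + x) :: v) 1

/-- The `(α, β)`-deformed quasi-shuffle `u ⋆ v` of two words, with `ε ⋆ w = w ⋆ ε = w` and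
`au ⋆ bv = a(u ⋆ bv) + b(au ⋆ v) + α [a+b](u ⋆ v) + β ζ_{a+b}(u ⋆ v)`. -/
def deformedShuffle {R : Type*} [CommRing R] (α β : R) : List ℕ+ → List ℕ+ → Words R
  | [], w => Finsupp.single w 1
  | a :: u, [] => Finsupp.single (a :: u) 1
  | a :: u, b :: v =>
      prepend a (deformedShuffle α β u (b :: v)) + prepend b (deformedShuffle α β (a :: u) v)
        + α • prepend (a + b) (deformedShuffle α β u v) + β • zeta (a + b) (deformedShuffle α β u v)
termination_by u v => u.length + v.length

/-- The bilinear extension of `⋆` to linear combinations of words. -/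
def starMul {R : Type*} [CommRing R] (α β : R) (p q : Words R) : Words R :=
  p.sum fun u c => q.sum fun v d => (c * d) • deformedShuffle α β u v

/-- The shuffle of two words: `au ⧢ bv = a(u ⧢ bv) + b(au ⧢ v)`. -/
def shuffle (R : Type*) [CommRing R] : List ℕ+ → List ℕ+ → Words R
  | [], w => Finsupp.single w 1
  | a :: u, [] => Finsupp.single (a :: u) 1
  | a :: u, b :: v => prepend a (shuffle R u (b :: v)) + prepend b (shuffle R (a :: u) v)
termination_by u v => u.length + v.length

/-- The quasi-shuffle of two words: `au * bv = a(u * bv) + b(au * v) + [a+b](u * v)`. -/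
def quasiShuffle (R : Type*) [CommRing R] : List ℕ+ → List ℕ+ → Words R
  | [], w => Finsupp.single w 1
  | a :: u, [] => Finsupp.single (a :: u) 1
  | a :: u, b :: v =>
      prepend a (quasiShuffle R u (b :: v)) + prepend b (quasiShuffle R (a :: u) v)
        + prepend (a + b) (quasiShuffle R u v)
termination_by u v => u.length + v.length

/-- The block shuffle of two words: `au ⋄ bv = a(u ⋄ bv) + b(au ⋄ v) - ζ_{a+b}(u ⋄ v)`. -/
def blockShuffle (R : Type*) [CommRing R] : List ℕ+ → List ℕ+ → Words R
  | [], w => Finsupp.single w 1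
  | a :: u, [] => Finsupp.single (a :: u) 1
  | a :: u, b :: v =>
      prepend a (blockShuffle R u (b :: v)) + prepend b (blockShuffle R (a :: u) v)
        - zeta (a + b) (blockShuffle R u v)
termination_by u v => u.length + v.length

end

end EulerianQSym

open EulerianQSym

namespace EulerianQSym

noncomputable section

open Finset
open scoped TensorProduct

/-! ### Evaluation of bivariate power series at commuting noncommutative series -/

section Evaluation

variable {R A : Type*} [CommRing R] [Ring A] [Algebra R A]

/-! Everything rests on the addition formula f(x+y) = f(x) + f(y) + α f(x)f(y) + β f(x)f(y)f(x+y)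
(`compose_add_of_commute`). With h(x) = (e^{(t-s)x} - 1)/(t-s), recording permutations by their
first value gives f = h (1 + s f) (`eulerianSeries_eq`), and the formula follows from h(x+y) = h(x)
+ h(y) + (t-s) h(x)h(y). Since t-s may be a zero divisor, h is handled through its coefficients and
no denominator is ever inverted.

The coproduct Δ makes σ grouplike, so φ = log σ is primitive: Δφ is the sum of the commuting series
φ⊗1 and 1⊗φ. The addition formula then gives ΔY = Y⊗1 + 1⊗Y + α Y⊗Y + β (Y⊗Y) ΔY (`coproduct_yGen`).
Multiplying its component of degree c by ΔY^K and taking the coefficient of Y^{au} ⊗ Y^{bv} leaves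
four cases: a = c, b = c, a+b = c, and a+b < c, where the letter c-a-b stays in front of K. This is
exactly the recursion for the coefficient of cK in au ⋆ bv (`yCoord_coproduct_yMul`).

Because f = x + ⋯ has a compositional inverse, S_n ↦ Y_n extends to a graded automorphism of the
free algebra (`yEquiv`), so the Y^I form a basis. Quasi-symmetric functions are exactly the
functionals vanishing in large degree (`pairing_injective`, `exists_pairing_eq`), which gives the
dual basis X_I, and their product is dual to Δ (`pairing_mul`). Hence X_I X_J = X(I ⋆ J), and ⋆
inherits commutativity and associativity through the injective map X. -/

theorem coeff_pow_mul_pow_eq_zero {u v : PowerSeries A} (hu : PowerSeries.constantCoeff u = 0)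
    (hv : PowerSeries.constantCoeff v = 0) {n i j : ℕ} (h : n < i + j) :
    PowerSeries.coeff n (u ^ i * v ^ j) = 0 := by
  apply PowerSeries.coeff_of_lt_order
  refine lt_of_lt_of_le ?_ ((add_le_add
    (PowerSeries.le_order_pow_of_constantCoeff_eq_zero i hu)
    (PowerSeries.le_order_pow_of_constantCoeff_eq_zero j hv)).trans
      (PowerSeries.le_order_mul (u ^ i) (v ^ j)))
  exact_mod_cast h

theorem coeff_pow_mul_eq_zero {u : PowerSeries A} (hu : PowerSeries.constantCoeff u = 0)
    (w : PowerSeries A) {n i : ℕ} (h : n < i) : PowerSeries.coeff n (u ^ i * w) = 0 := by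
  apply PowerSeries.coeff_of_lt_order
  refine lt_of_lt_of_le ?_ ((le_add_right
    (PowerSeries.le_order_pow_of_constantCoeff_eq_zero i hu)).trans
      (PowerSeries.le_order_mul (u ^ i) w))
  exact_mod_cast h

/-- Bivariate exponents with both entries at most `n`. -/
def box (n : ℕ) : Finset (Fin 2 →₀ ℕ) :=
  Finset.Icc 0 (Finsupp.equivFunOnFinite.symm fun _ => n)

theorem mem_box {n : ℕ} {m : Fin 2 →₀ ℕ} : m ∈ box n ↔ m 0 ≤ n ∧ m 1 ≤ n := by
  simp [box, Finsupp.le_def, Fin.forall_fin_two]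

/-- The coefficients of the evaluation of a bivariate power series at `(u, v)`. -/
def evalPairFun (u v : PowerSeries A) (F : MvPowerSeries (Fin 2) R) : PowerSeries A :=
  PowerSeries.mk fun n =>
    ∑ m ∈ box n, MvPowerSeries.coeff m F • PowerSeries.coeff n (u ^ m 0 * v ^ m 1)

/-- Exponents outside the box of size n contribute nothing to degree n, so one box of size N serves
all coefficients of degree at most N at once. -/
theorem coeff_evalPairFun {u v : PowerSeries A} (hu : PowerSeries.constantCoeff u = 0)
    (hv : PowerSeries.constantCoeff v = 0) (F : MvPowerSeries (Fin 2) R) {n N : ℕ} (h : n ≤ N) :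
    PowerSeries.coeff n (evalPairFun u v F) =
      ∑ m ∈ box N, MvPowerSeries.coeff m F • PowerSeries.coeff n (u ^ m 0 * v ^ m 1) := by
  rw [evalPairFun, PowerSeries.coeff_mk]
  refine Finset.sum_subset (fun m hm => ?_) fun m _ hm => ?_
  · rw [mem_box] at hm ⊢
    omega
  · rw [mem_box] at hm
    rw [coeff_pow_mul_pow_eq_zero hu hv (by omega), smul_zero]

theorem evalPairFun_one {u v : PowerSeries A} :
    evalPairFun u v (1 : MvPowerSeries (Fin 2) R) = 1 := by
  classical
  ext n
  rw [evalPairFun, PowerSeries.coeff_mk, Finset.sum_eq_single 0]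
  · simp
  · intro m _ hm
    rw [MvPowerSeries.coeff_one, if_neg hm, zero_smul]
  · intro h
    simp [mem_box] at h

theorem evalPairFun_mul {u v : PowerSeries A} (hu : PowerSeries.constantCoeff u = 0)
    (hv : PowerSeries.constantCoeff v = 0) (huv : Commute u v) (F G : MvPowerSeries (Fin 2) R) :
    evalPairFun u v (F * G) = evalPairFun u v F * evalPairFun u v G := by
  classical
  ext n
  have key : ∀ m m' : Fin 2 →₀ ℕ, (u ^ m 0 * v ^ m 1) * (u ^ m' 0 * v ^ m' 1)
      = u ^ (m + m') 0 * v ^ (m + m') 1 := fun m m' => by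
    rw [Finsupp.add_apply, Finsupp.add_apply, pow_add, pow_add, mul_assoc, mul_assoc,
      ← mul_assoc (v ^ m 1), ← mul_assoc (u ^ m' 0), (huv.pow_pow (m' 0) (m 1)).eq]
  have h1 : PowerSeries.coeff n (evalPairFun u v F * evalPairFun u v G) =
      ∑ p ∈ box n ×ˢ box n, (MvPowerSeries.coeff p.1 F * MvPowerSeries.coeff p.2 G) •
        PowerSeries.coeff n (u ^ (p.1 + p.2) 0 * v ^ (p.1 + p.2) 1) := by
    rw [PowerSeries.coeff_mul]
    calc _ = ∑ q ∈ antidiagonal n, ∑ p ∈ box n ×ˢ box n,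
          (MvPowerSeries.coeff p.1 F * MvPowerSeries.coeff p.2 G) •
            (PowerSeries.coeff q.1 (u ^ p.1 0 * v ^ p.1 1) *
              PowerSeries.coeff q.2 (u ^ p.2 0 * v ^ p.2 1)) := by
          refine Finset.sum_congr rfl fun q hq => ?_
          have hq' := Finset.HasAntidiagonal.mem_antidiagonal.1 hq
          rw [coeff_evalPairFun hu hv F (show q.1 ≤ n by omega),
            coeff_evalPairFun hu hv G (show q.2 ≤ n by omega), Finset.sum_mul_sum,
            Finset.sum_product]
          simp only [smul_mul_smul_comm]
      _ = _ := by
          rw [Finset.sum_comm]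
          refine Finset.sum_congr rfl fun p _ => ?_
          rw [← key, PowerSeries.coeff_mul, Finset.smul_sum]
  -- Pairs whose sum leaves the box contribute zero; the remaining ones, grouped by their sum k,
  -- fill the antidiagonal of k.
  rw [h1, ← Finset.sum_filter_of_ne (p := fun p : (Fin 2 →₀ ℕ) × (Fin 2 →₀ ℕ) => p.1 + p.2 ∈ box n)]
  · rw [evalPairFun, PowerSeries.coeff_mk,
      ← Finset.sum_fiberwise_of_maps_to (t := box n) (g := fun p : (Fin 2 →₀ ℕ) × (Fin 2 →₀ ℕ) => p.1 + p.2)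
        (fun p hp => (Finset.mem_filter.1 hp).2)]
    refine Finset.sum_congr rfl fun k hk => ?_
    rw [MvPowerSeries.coeff_mul, Finset.sum_smul]
    have : ((box n ×ˢ box n).filter fun p : (Fin 2 →₀ ℕ) × (Fin 2 →₀ ℕ) => p.1 + p.2 ∈ box n).filter
        (fun p : (Fin 2 →₀ ℕ) × (Fin 2 →₀ ℕ) => p.1 + p.2 = k) = antidiagonal k := by
      ext p
      rw [mem_box] at hk
      simp only [Finset.mem_filter, Finset.mem_product, mem_box, Finset.HasAntidiagonal.mem_antidiagonal]
      constructor
      · exact fun h => h.2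
      · rintro rfl
        simp only [Finsupp.add_apply] at hk ⊢
        refine ⟨⟨⟨⟨?_, ?_⟩, ?_, ?_⟩, hk⟩, trivial⟩ <;> omega
    rw [this]
    refine Finset.sum_congr rfl fun p hp => ?_
    rw [Finset.HasAntidiagonal.mem_antidiagonal.1 hp]
  · intro p _ hp
    rw [mem_box]
    by_contra hcon
    exact hp (by rw [coeff_pow_mul_pow_eq_zero hu hv (by omega), smul_zero])

/-- Evaluation of a bivariate power series at a pair of commuting series without constant term. -/
def evalPair (u v : PowerSeries A) (hu : PowerSeries.constantCoeff u = 0)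
    (hv : PowerSeries.constantCoeff v = 0) (huv : Commute u v) :
    MvPowerSeries (Fin 2) R →ₐ[R] PowerSeries A :=
  AlgHom.ofLinearMap
    { toFun := evalPairFun u v
      map_add' := fun F G => by
        ext n
        simp [evalPairFun, add_smul, Finset.sum_add_distrib]
      map_smul' := fun r F => by
        ext n
        simp [evalPairFun, Finset.smul_sum, mul_smul] }
    evalPairFun_one (evalPairFun_mul hu hv huv)

variable {u v : PowerSeries A} (hu : PowerSeries.constantCoeff u = 0)
  (hv : PowerSeries.constantCoeff v = 0) (huv : Commute u v)

theorem coeff_evalPair (F : MvPowerSeries (Fin 2) R) {n N : ℕ} (h : n ≤ N) :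
    PowerSeries.coeff n (evalPair u v hu hv huv F) =
      ∑ m ∈ box N, MvPowerSeries.coeff m F • PowerSeries.coeff n (u ^ m 0 * v ^ m 1) :=
  coeff_evalPairFun hu hv F h

theorem evalPair_X_zero : evalPair u v hu hv huv (MvPowerSeries.X 0 : MvPowerSeries _ R) = u := by
  classical
  ext n
  rw [coeff_evalPair hu hv huv _ (Nat.le_succ n), Finset.sum_eq_single (Finsupp.single 0 1)]
  · simp
  · intro m _ hm
    rw [MvPowerSeries.coeff_X, if_neg hm, zero_smul]
  · intro h
    simp [mem_box] at h

theorem evalPair_X_one : evalPair u v hu hv huv (MvPowerSeries.X 1 : MvPowerSeries _ R) = v := by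
  classical
  ext n
  rw [coeff_evalPair hu hv huv _ (Nat.le_succ n), Finset.sum_eq_single (Finsupp.single 1 1)]
  · simp
  · intro m _ hm
    rw [MvPowerSeries.coeff_X, if_neg hm, zero_smul]
  · intro h
    simp [mem_box] at h

/-- Algebra homomorphisms into power series commute with substitution. -/
theorem map_subst_eq_compose {τ : Type*} (Φ : MvPowerSeries τ R →ₐ[R] PowerSeries A)
    (g : PowerSeries R) {a : MvPowerSeries τ R} (ha : MvPowerSeries.constantCoeff a = 0)
    (hΦ : PowerSeries.constantCoeff (Φ a) = 0) : Φ (g.subst a) = compose g (Φ a) := by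
  ext n
  have hs : PowerSeries.HasSubst a := PowerSeries.HasSubst.of_constantCoeff_zero ha
  -- No continuity of `Φ` is needed: g is x^{n+1} times a series plus a polynomial. The first part
  -- maps to a multiple of `(Φ a) ^ (n + 1)`, invisible in degree n, and on the polynomial any
  -- algebra homomorphism commutes with evaluation.
  rw [PowerSeries.eq_X_pow_mul_shift_add_trunc (n + 1) g, PowerSeries.subst_add hs,
    PowerSeries.subst_mul hs, PowerSeries.subst_pow hs, PowerSeries.subst_X hs,
    PowerSeries.subst_coe hs, map_add, map_mul, map_pow, map_add,
    coeff_pow_mul_eq_zero hΦ _ (Nat.lt_succ_self n), zero_add, ← Polynomial.aeval_algHom_apply,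
    Polynomial.aeval_eq_sum_range' (n := n + 1) (PowerSeries.natDegree_trunc_lt g n), map_sum,
    compose, PowerSeries.coeff_mk]
  refine Finset.sum_congr rfl fun k hk => ?_
  have hk' := Finset.mem_range.1 hk
  rw [PowerSeries.coeff_smul, PowerSeries.coeff_trunc, if_pos hk', map_add, PowerSeries.coeff_X_pow_mul',
    if_neg (by omega), zero_add, Polynomial.coeff_coe, PowerSeries.coeff_trunc, if_pos hk']

theorem constantCoeff_compose {g : PowerSeries R} (hg : PowerSeries.constantCoeff g = 0)
    (u : PowerSeries A) : PowerSeries.constantCoeff (compose g u) = 0 := by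
  rw [← PowerSeries.coeff_zero_eq_constantCoeff_apply, compose, PowerSeries.coeff_mk]
  simp [hg]

/-- Substitution of a fixed series without constant term is an algebra homomorphism. -/
theorem exists_algHom_eq_compose {u : PowerSeries A} (hu : PowerSeries.constantCoeff u = 0) :
    ∃ Φ : PowerSeries R →ₐ[R] PowerSeries A, (∀ g, Φ g = compose g u) ∧ Φ PowerSeries.X = u := by
  have hX := PowerSeries.HasSubst.X (S := R) (0 : Fin 2)
  have h : ∀ g : PowerSeries R, evalPair u u hu hu (Commute.refl u)
      (g.subst (MvPowerSeries.X (0 : Fin 2) : MvPowerSeries (Fin 2) R)) = compose g u := fun g => by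
    rw [map_subst_eq_compose _ _ (by simp), evalPair_X_zero]
    rw [evalPair_X_zero, hu]
  refine ⟨(evalPair u u hu hu (Commute.refl u)).comp (PowerSeries.substAlgHom hX), fun g => ?_, ?_⟩
  · rw [AlgHom.comp_apply, PowerSeries.coe_substAlgHom, h]
  · rw [AlgHom.comp_apply, PowerSeries.substAlgHom_X, evalPair_X_zero]

theorem compose_compose {u : PowerSeries A} (hu : PowerSeries.constantCoeff u = 0)
    (g : PowerSeries R) {a : PowerSeries R} (ha : PowerSeries.constantCoeff a = 0) :
    compose g (compose a u) = compose (g.subst a) u := by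
  obtain ⟨Φ, hΦ, -⟩ := exists_algHom_eq_compose (R := R) hu
  rw [← hΦ, ← hΦ, ← map_subst_eq_compose Φ g ha]
  rw [hΦ, constantCoeff_compose ha]

theorem compose_X {u : PowerSeries A} (hu : PowerSeries.constantCoeff u = 0) :
    compose (PowerSeries.X : PowerSeries R) u = u := by
  obtain ⟨Φ, hΦ, hX⟩ := exists_algHom_eq_compose (R := R) hu
  rw [← hΦ, hX]

theorem map_compose {B : Type*} [Ring B] [Algebra R B] (F : A →ₐ[R] B) (g : PowerSeries R)
    (u : PowerSeries A) :
    PowerSeries.map (F : A →+* B) (compose g u) = compose g (PowerSeries.map (F : A →+* B) u) := by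
  ext n
  simp only [compose, PowerSeries.coeff_map, PowerSeries.coeff_mk, ← map_pow, RingHom.coe_coe,
    map_sum, map_smul]

end Evaluation

/-! ### Exponential, logarithm and the addition formula -/

section Series

/-- A one-sided compositional inverse of a series without constant term is two-sided. -/
theorem subst_eq_X_comm {R : Type*} [CommRing R] {p q : PowerSeries R} (hp : PowerSeries.constantCoeff p = 0)
    (hp1 : IsUnit (PowerSeries.coeff 1 p)) (hq : PowerSeries.constantCoeff q = 0)
    (h : p.subst q = (PowerSeries.X : PowerSeries R)) :
    q.subst p = (PowerSeries.X : PowerSeries R) := by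
  have hl := PowerSeries.subst_substInvOfIsUnit_left p hp hp1
  have hqs := PowerSeries.HasSubst.of_constantCoeff_zero' hq
  have hps := PowerSeries.HasSubst.of_constantCoeff_zero' hp
  -- Substituting q into the left inverse identity for p shows that a right inverse must be the
  -- two-sided one.
  have : q = p.substInvOfIsUnit hp1 := by
    have h2 := congrArg (PowerSeries.subst q) hl
    rwa [PowerSeries.subst_comp_subst_apply hps hqs, h, PowerSeries.subst_X hqs,
      PowerSeries.X_subst, eq_comm] at h2
  rw [this, hl]

variable {R : Type*} [CommRing R] [Algebra ℚ R]

/-- The series `(e ^ (c x) - 1) / c`. -/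
def dividedExp (c : R) : PowerSeries R :=
  PowerSeries.mk fun n =>
    if n = 0 then 0 else algebraMap ℚ R (1 / (n.factorial : ℚ)) * c ^ (n - 1)

theorem C_mul_dividedExp (c : R) :
    PowerSeries.C c * dividedExp c = PowerSeries.rescale c (PowerSeries.exp R) - 1 := by
  ext n
  rw [PowerSeries.coeff_C_mul, dividedExp, PowerSeries.coeff_mk, map_sub, PowerSeries.coeff_rescale,
    PowerSeries.coeff_exp, PowerSeries.coeff_one]
  rcases n with _ | n
  · simp
  · simp only [Nat.succ_ne_zero, if_false, Nat.add_sub_cancel, pow_succ]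
    ring

theorem choose_mul_inv_factorial (i j : ℕ) :
    ((i + j).choose i : R) * algebraMap ℚ R (1 / ((i + j).factorial : ℚ)) =
      algebraMap ℚ R (1 / (i.factorial : ℚ)) * algebraMap ℚ R (1 / (j.factorial : ℚ)) := by
  rw [← map_natCast (algebraMap ℚ R), ← map_mul, ← map_mul, Nat.cast_add_choose ℚ]
  congr 1
  have h1 : ((i + j).factorial : ℚ) ≠ 0 := by positivity
  have h2 : (i.factorial : ℚ) ≠ 0 := by positivity
  have h3 : (j.factorial : ℚ) ≠ 0 := by positivity
  field_simp

theorem exp_subst_add :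
    (PowerSeries.exp R).subst (MvPowerSeries.X 0 + MvPowerSeries.X 1 : MvPowerSeries (Fin 2) R) =
      (PowerSeries.exp R).subst (MvPowerSeries.X 0 : MvPowerSeries (Fin 2) R) *
        (PowerSeries.exp R).subst (MvPowerSeries.X 1 : MvPowerSeries (Fin 2) R) := by
  ext e
  rw [PowerSeries.coeff_subst_X_zero_add_X_one, PowerSeries.coeff_subst_X_zero_subst_mul_X_one,
    PowerSeries.coeff_exp, PowerSeries.coeff_exp, PowerSeries.coeff_exp, choose_mul_inv_factorial]

/-- Compared coefficientwise, since deducing it from the exponential would require cancelling c. For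
positive i, j the power c^{i+j-1} splits as c · c^{i-1} · c^{j-1}; if i or j is zero only a linear
term survives. -/
theorem dividedExp_subst_add (c : R) :
    (dividedExp c).subst (MvPowerSeries.X 0 + MvPowerSeries.X 1 : MvPowerSeries (Fin 2) R) =
      (dividedExp c).subst (MvPowerSeries.X 0 : MvPowerSeries (Fin 2) R) +
        (dividedExp c).subst (MvPowerSeries.X 1 : MvPowerSeries (Fin 2) R) +
        c • ((dividedExp c).subst (MvPowerSeries.X 0 : MvPowerSeries (Fin 2) R) *
          (dividedExp c).subst (MvPowerSeries.X 1 : MvPowerSeries (Fin 2) R)) := by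
  classical
  ext e
  rw [PowerSeries.coeff_subst_X_zero_add_X_one, map_add, map_add, MvPowerSeries.coeff_smul,
    PowerSeries.coeff_subst_X_zero_subst_mul_X_one, PowerSeries.coeff_subst_single,
    PowerSeries.coeff_subst_single]
  have h0 : e = Finsupp.single 0 (e 0) ↔ e 1 = 0 := by
    constructor
    · intro h; rw [h]; simp
    · intro h; ext i; fin_cases i <;> simp [h]
  have h1 : e = Finsupp.single 1 (e 1) ↔ e 0 = 0 := by
    constructor
    · intro h; rw [h]; simp
    · intro h; ext i; fin_cases i <;> simp [h]
  simp only [h0, h1, dividedExp, PowerSeries.coeff_mk]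
  generalize e 0 = i
  generalize e 1 = j
  rcases i with _ | i
  · rcases j with _ | j <;> simp
  · rcases j with _ | j
    · simp
    · have h := choose_mul_inv_factorial (R := R) (i + 1) (j + 1)
      have h2 : i + 1 + (j + 1) - 1 = i + j + 1 := by omega
      simp only [Nat.succ_ne_zero, if_false, Nat.add_sub_cancel, h2, add_zero, zero_add,
        show i + 1 + (j + 1) ≠ 0 by omega, ← mul_assoc, h]
      ring

/-- The composite g satisfies (1+x) g' = g and g(0) = 1, so (n+1) g_{n+1} = (1-n) g_n. This forces
g_1 = 1, and the factor 1-n at n = 1 kills every later coefficient. -/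
theorem exp_subst_log : (PowerSeries.exp R).subst (PowerSeries.log R) = 1 + PowerSeries.X := by
  set g : PowerSeries R := (PowerSeries.exp R).subst (PowerSeries.log R) with hg
  have h1 : PowerSeries.derivative R g =
      g * PowerSeries.derivative R (PowerSeries.log R) := by
    rw [hg, PowerSeries.derivative_subst PowerSeries.HasSubst.log, PowerSeries.derivative_exp]
  have h2 : (1 + PowerSeries.X) * PowerSeries.derivative R (PowerSeries.log R) = 1 := by
    rw [PowerSeries.deriv_log]
    ext n
    rcases n with _ | n
    · simp [add_mul]
    · simp [add_mul, PowerSeries.coeff_succ_X_mul, PowerSeries.coeff_one, pow_succ]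
  have h3 : (1 + PowerSeries.X) * PowerSeries.derivative R g = g := by
    rw [h1, mul_left_comm, h2, mul_one]
  have h4 : PowerSeries.coeff 0 g = 1 := by
    rw [hg, PowerSeries.coeff_subst' PowerSeries.HasSubst.log, finsum_eq_single _ 0]
    · simp
    · intro n hn
      simp [hn]
  have h5 : ∀ n : ℕ, ((n : R) + 1) * PowerSeries.coeff (n + 1) g =
      (1 - (n : R)) * PowerSeries.coeff n g := fun n => by
    have := congrArg (PowerSeries.coeff n) h3
    rw [add_mul, one_mul, map_add, PowerSeries.coeff_derivative] at this
    rcases n with _ | n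
    · simp at this
      simp [this]
    · rw [PowerSeries.coeff_succ_X_mul, PowerSeries.coeff_derivative] at this
      push_cast at this ⊢
      linear_combination this
  have hinv : ∀ (n : ℕ) (x y : R), ((n : R) + 1) * x = ((n : R) + 1) * y → x = y :=
    fun n x y h => by
    have hu : IsUnit ((n : R) + 1) := by
      have : ((n : R) + 1) = algebraMap ℚ R ((n : ℚ) + 1) := by simp
      rw [this]
      exact (IsUnit.mk0 _ (by positivity)).map _
    exact hu.mul_left_cancel h
  have h6 : PowerSeries.coeff 1 g = 1 := hinv 0 _ _ (by rw [h5 0, h4]; simp)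
  have h7 : ∀ n, PowerSeries.coeff (n + 2) g = 0 := fun n => by
    induction n with
    | zero => exact hinv 1 _ _ (by rw [h5 1]; simp)
    | succ n ih => exact hinv (n + 2) _ _ (by rw [h5 (n + 2), ih]; simp)
  ext n
  rcases n with _ | _ | n
  · rw [h4]; simp
  · rw [h6]; simp [PowerSeries.coeff_one]
  · rw [h7]; simp [PowerSeries.coeff_one, PowerSeries.coeff_X]

theorem exp_sub_one_subst_log :
    (PowerSeries.exp R - 1).subst (PowerSeries.log R) = (PowerSeries.X : PowerSeries R) := by
  rw [PowerSeries.subst_sub PowerSeries.HasSubst.log, exp_subst_log,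
    ← PowerSeries.coe_substAlgHom PowerSeries.HasSubst.log, map_one, add_sub_cancel_left]

theorem log_subst_exp_sub_one :
    (PowerSeries.log R).subst (PowerSeries.exp R - 1) = (PowerSeries.X : PowerSeries R) :=
  subst_eq_X_comm (by simp) (by simp [PowerSeries.coeff_one]) (by simp) exp_sub_one_subst_log

end Series

/-! ### Logarithms of products and the Eulerian series of a sum, for commuting series. -/

section Addition

variable {R A : Type*} [CommRing R] [Algebra ℚ R] [Ring A] [Algebra R A]

/-- Here v + w + vw = (1+v)(1+w) - 1. Exponentiating the sum of the logarithms gives (1+v)(1+w), and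
log inverts exp - 1. Applied to σ⊗1 and 1⊗σ, this says that φ is primitive. -/
theorem compose_log_add_of_commute {v w : PowerSeries A} (hv : PowerSeries.constantCoeff v = 0)
    (hw : PowerSeries.constantCoeff w = 0) (hvw : Commute v w) :
    Commute (compose (PowerSeries.log R) v) (compose (PowerSeries.log R) w) ∧
      compose (PowerSeries.log R) (v + w + v * w) =
        compose (PowerSeries.log R) v + compose (PowerSeries.log R) w := by
  have hlog := PowerSeries.constantCoeff_log (A := R)
  have hexp : PowerSeries.constantCoeff (PowerSeries.exp R - 1) = 0 := by simp
  have hL : ∀ (u : PowerSeries A), PowerSeries.constantCoeff u = 0 →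
      compose (PowerSeries.exp R) (compose (PowerSeries.log R) u) = 1 + u := fun u hu => by
    obtain ⟨Φ, hΦ, hX⟩ := exists_algHom_eq_compose (R := R) hu
    rw [compose_compose hu _ hlog, exp_subst_log, ← hΦ, map_add, map_one, hX]
  -- Both logarithms are images of bivariate series, which commute, under one and the same
  -- homomorphism.
  have hcomm : Commute (compose (PowerSeries.log R) v) (compose (PowerSeries.log R) w) := by
    have h0 := map_subst_eq_compose (evalPair v w hv hw hvw) (PowerSeries.log R)
      (a := MvPowerSeries.X 0) (by simp) (by rw [evalPair_X_zero, hv])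
    have h1 := map_subst_eq_compose (evalPair v w hv hw hvw) (PowerSeries.log R)
      (a := MvPowerSeries.X 1) (by simp) (by rw [evalPair_X_one, hw])
    rw [evalPair_X_zero] at h0
    rw [evalPair_X_one] at h1
    rw [← h0, ← h1]
    exact (Commute.all _ _).map _
  refine ⟨hcomm, ?_⟩
  have h1 := constantCoeff_compose hlog v
  have h2 := constantCoeff_compose hlog w
  set φ := compose (PowerSeries.log R) v with hφ
  set ψ := compose (PowerSeries.log R) w with hψ
  have h12 : PowerSeries.constantCoeff (φ + ψ) = 0 := by rw [map_add, h1, h2, add_zero]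
  have key : compose (PowerSeries.exp R) (φ + ψ) =
      compose (PowerSeries.exp R) φ * compose (PowerSeries.exp R) ψ := by
    have e := congrArg (evalPair φ ψ h1 h2 hcomm) (exp_subst_add (R := R))
    rwa [map_mul, map_subst_eq_compose _ _ (by simp), map_subst_eq_compose _ _ (by simp),
      map_subst_eq_compose _ _ (by simp), map_add, evalPair_X_zero, evalPair_X_one] at e
    · rw [evalPair_X_one, h2]
    · rw [evalPair_X_zero, h1]
    · rw [map_add, evalPair_X_zero, evalPair_X_one, h12]
  have h3 : compose (PowerSeries.exp R - 1) (φ + ψ) = v + w + v * w := by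
    obtain ⟨Φ, hΦ, -⟩ := exists_algHom_eq_compose (R := R) h12
    rw [← hΦ, map_sub, map_one, hΦ, key, hL v hv, hL w hw]
    noncomm_ring
  rw [← h3, compose_compose h12 _ hexp, log_subst_exp_sub_one, compose_X h12]

/-- The addition formula `f(x + y) (1 - s t f(x) f(y)) = f(x) + f(y) + (s + t) f(x) f(y)`, for
commuting `x` and `y`. -/
theorem compose_add_of_commute {s t : R} {f : PowerSeries R}
    (hf : f = dividedExp (s - t) + PowerSeries.C t * f * dividedExp (s - t))
    {φ ψ : PowerSeries A} (h1 : PowerSeries.constantCoeff φ = 0)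
    (h2 : PowerSeries.constantCoeff ψ = 0) (hcomm : Commute φ ψ) :
    compose f (φ + ψ) = compose f φ + compose f ψ + (s + t) • (compose f φ * compose f ψ) +
      (s * t) • (compose f φ * compose f ψ * compose f (φ + ψ)) := by
  have hsub : ∀ a : MvPowerSeries (Fin 2) R, MvPowerSeries.constantCoeff a = 0 →
      f.subst a = (dividedExp (s - t)).subst a +
        t • (f.subst a * (dividedExp (s - t)).subst a) := fun a ha => by
    have hs := PowerSeries.HasSubst.of_constantCoeff_zero ha
    have := congrArg (PowerSeries.subst a) hf
    rwa [PowerSeries.subst_add hs, mul_assoc, ← PowerSeries.smul_eq_C_mul, PowerSeries.subst_smul hs,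
      PowerSeries.subst_mul hs] at this
  have e0 := hsub (MvPowerSeries.X 0) (by simp)
  have e1 := hsub (MvPowerSeries.X 1) (by simp)
  have e2 := hsub (MvPowerSeries.X 0 + MvPowerSeries.X 1) (by simp)
  have e3 := dividedExp_subst_add (s - t)
  have key : f.subst (MvPowerSeries.X 0 + MvPowerSeries.X 1 : MvPowerSeries (Fin 2) R) =
      f.subst (MvPowerSeries.X 0 : MvPowerSeries (Fin 2) R) +
        f.subst (MvPowerSeries.X 1 : MvPowerSeries (Fin 2) R) +
        (s + t) • (f.subst (MvPowerSeries.X 0 : MvPowerSeries (Fin 2) R) *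
          f.subst (MvPowerSeries.X 1 : MvPowerSeries (Fin 2) R)) +
        (s * t) • (f.subst (MvPowerSeries.X 0 : MvPowerSeries (Fin 2) R) *
          f.subst (MvPowerSeries.X 1 : MvPowerSeries (Fin 2) R) *
          f.subst (MvPowerSeries.X 0 + MvPowerSeries.X 1 : MvPowerSeries (Fin 2) R)) := by
    simp only [MvPowerSeries.smul_eq_C_mul, map_add, map_mul, map_sub] at e0 e1 e2 e3 ⊢
    generalize f.subst (MvPowerSeries.X 0 + MvPowerSeries.X 1 : MvPowerSeries (Fin 2) R) = F2
      at *
    generalize f.subst (MvPowerSeries.X 0 : MvPowerSeries (Fin 2) R) = F0 at *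
    generalize f.subst (MvPowerSeries.X 1 : MvPowerSeries (Fin 2) R) = F1 at *
    generalize (dividedExp (s - t)).subst
      (MvPowerSeries.X 0 + MvPowerSeries.X 1 : MvPowerSeries (Fin 2) R) = H2 at *
    generalize (dividedExp (s - t)).subst (MvPowerSeries.X 0 : MvPowerSeries (Fin 2) R) = H0 at *
    generalize (dividedExp (s - t)).subst (MvPowerSeries.X 1 : MvPowerSeries (Fin 2) R) = H1 at *
    generalize MvPowerSeries.C s = S at *
    generalize MvPowerSeries.C t = T at *
    -- Formally H = F/(1 + TF). The addition law for H is cleared of these denominators; multiplying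
    -- the equation for F2 by both factors then makes the terms T F2 (F0 + F1) and T² F0 F1 F2
    -- cancel.
    have g : H2 * ((1 + T * F0) * (1 + T * F1)) = F0 + F1 + (S + T) * (F0 * F1) := by
      rw [e3]
      linear_combination (-(1 + T * F1) - (S - T) * (H1 * (1 + T * F1))) * e0 +
        (-(1 + T * F0) - (S - T) * F0) * e1
    linear_combination ((1 + T * F0) * (1 + T * F1)) * e2 + (1 + T * F2) * g
  have e := congrArg (evalPair φ ψ h1 h2 hcomm) key
  have h12 : PowerSeries.constantCoeff (φ + ψ) = 0 := by rw [map_add, h1, h2, add_zero]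
  simp only [map_add, map_smul, map_mul] at e
  rwa [map_subst_eq_compose _ _ (by simp), map_subst_eq_compose _ _ (by simp),
      map_subst_eq_compose _ _ (by simp), map_add, evalPair_X_zero, evalPair_X_one] at e
  · rw [evalPair_X_one, h2]
  · rw [evalPair_X_zero, h1]
  · rw [map_add, evalPair_X_zero, evalPair_X_one, h12]

end Addition

/-! ### The generating function of the Eulerian polynomials -/

section Eulerian

theorem rises_eq_sum {n : ℕ} (σ : Equiv.Perm (Fin (n + 1))) :
    rises σ = ∑ i : Fin n, if σ i.castSucc < σ i.succ then 1 else 0 := by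
  rw [rises, Fintype.card_subtype, Finset.card_filter, Fin.sum_univ_castSucc]
  simp [Fin.succ]

theorem descents_eq_sum {n : ℕ} (σ : Equiv.Perm (Fin (n + 1))) :
    descents σ = ∑ i : Fin n, if σ i.succ < σ i.castSucc then 1 else 0 := by
  rw [descents, Fintype.card_subtype, Finset.card_filter, Fin.sum_univ_castSucc]
  simp [Fin.succ]

/-- The permutation of `{0, …, n}` with first value `p` whose remaining values are ordered as those
of `τ`. -/
def insertFirst {n : ℕ} (p : Fin (n + 1)) (τ : Equiv.Perm (Fin n)) : Equiv.Perm (Fin (n + 1)) :=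
  p.cycleRange.symm * Equiv.Perm.decomposeFin.symm (0, τ)

theorem insertFirst_zero {n : ℕ} (p : Fin (n + 1)) (τ : Equiv.Perm (Fin n)) :
    insertFirst p τ 0 = p := by
  simp [insertFirst]

theorem insertFirst_succ {n : ℕ} (p : Fin (n + 1)) (τ : Equiv.Perm (Fin n)) (i : Fin n) :
    insertFirst p τ i.succ = p.succAbove (τ i) := by
  simp [insertFirst]

theorem insertFirst_bijective (n : ℕ) :
    Function.Bijective fun x : Fin (n + 1) × Equiv.Perm (Fin n) => insertFirst x.1 x.2 := by
  rw [Fintype.bijective_iff_injective_and_card]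
  constructor
  · rintro ⟨p, τ⟩ ⟨p', τ'⟩ h
    simp only at h
    have h0 : p = p' := by
      rw [← insertFirst_zero p τ, h, insertFirst_zero]
    subst h0
    have h1 : τ = τ' := by
      ext i
      have := congrArg (fun σ : Equiv.Perm (Fin (n + 1)) => σ i.succ) h
      simp only [insertFirst_succ] at this
      rw [Fin.succAbove_right_injective this]
    rw [h1]
  · simp [Fintype.card_perm, Nat.factorial_succ]

theorem lt_succAbove_iff_val_le {n : ℕ} (p : Fin (n + 1)) (i : Fin n) :
    p < p.succAbove i ↔ (p : ℕ) ≤ i := by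
  rw [Fin.lt_succAbove_iff_le_castSucc, Fin.le_def, Fin.val_castSucc]

theorem succAbove_lt_iff_not_val_le {n : ℕ} (p : Fin (n + 1)) (i : Fin n) :
    p.succAbove i < p ↔ ¬ (p : ℕ) ≤ i := by
  rw [Fin.succAbove_lt_iff_castSucc_lt, Fin.lt_def, Fin.val_castSucc, not_le]

variable {R : Type*} [CommRing R] (s t : R)

/-- Only one new comparison arises, between p and the value after it. As `succAbove` raises exactly
the values at least p, it is a rise precisely when p ≤ τ(0). -/
theorem weight_insertFirst {n : ℕ} (p : Fin (n + 2)) (τ : Equiv.Perm (Fin (n + 1))) :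
    s ^ rises (insertFirst p τ) * t ^ descents (insertFirst p τ) =
      (if (p : ℕ) ≤ τ 0 then s else t) * (s ^ rises τ * t ^ descents τ) := by
  rw [rises_eq_sum, descents_eq_sum, rises_eq_sum, descents_eq_sum, Fin.sum_univ_succ,
    Fin.sum_univ_succ]
  simp only [← Fin.succ_castSucc, insertFirst_succ, Fin.castSucc_zero, insertFirst_zero,
    Fin.succAbove_lt_succAbove_iff, lt_succAbove_iff_val_le, succAbove_lt_iff_not_val_le]
  split_ifs <;> ring

/-- The part of `E_{n+1}(s, t)` given by the permutations with first value `p`. -/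
def eulerianFirst (n p : ℕ) : R :=
  ∑ σ : Equiv.Perm (Fin (n + 1)), if (σ 0 : ℕ) = p then s ^ rises σ * t ^ descents σ else 0

theorem sum_eulerianFirst (n : ℕ) :
    ∑ p ∈ range (n + 1), eulerianFirst s t n p = eulerian s t (n + 1) := by
  simp only [eulerianFirst, eulerian]
  rw [Finset.sum_comm]
  refine Finset.sum_congr rfl fun σ _ => ?_
  rw [Finset.sum_ite_eq, if_pos (Finset.mem_range.2 (σ 0).2)]

theorem eulerianFirst_succ_eq_sum (n p : ℕ) (hp : p < n + 2) :
    eulerianFirst s t (n + 1) p = ∑ τ : Equiv.Perm (Fin (n + 1)),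
      (if p ≤ τ 0 then s else t) * (s ^ rises τ * t ^ descents τ) := by
  rw [eulerianFirst, ← (insertFirst_bijective (n + 1)).sum_comp, Fintype.sum_prod_type,
    Finset.sum_eq_single (⟨p, hp⟩ : Fin (n + 2))]
  · refine Finset.sum_congr rfl fun τ _ => ?_
    rw [insertFirst_zero, if_pos rfl, weight_insertFirst]
  · intro q _ hq
    refine Finset.sum_eq_zero fun τ _ => ?_
    rw [insertFirst_zero, if_neg]
    exact fun h => hq (Fin.ext h)
  · simp

theorem eulerianFirst_zero_zero : eulerianFirst s t 0 0 = 1 := by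
  have : Subsingleton (Fin (0 + 1)) := inferInstanceAs (Subsingleton (Fin 1))
  rw [eulerianFirst, Fintype.sum_subsingleton _ 1, rises_eq_sum, descents_eq_sum]
  simp

theorem eulerianFirst_succ_zero (n : ℕ) :
    eulerianFirst s t (n + 1) 0 = s * eulerian s t (n + 1) := by
  rw [eulerianFirst_succ_eq_sum _ _ _ _ (by omega), eulerian, Finset.mul_sum]
  simp

/-- Raising the first value from p to p+1 changes the first comparison from rise to descent only for
those τ with τ(0) = p. -/
theorem eulerianFirst_succ_succ (n p : ℕ) (hp : p ≤ n) :
    eulerianFirst s t (n + 1) (p + 1) =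
      eulerianFirst s t (n + 1) p + (t - s) * eulerianFirst s t n p := by
  rw [eulerianFirst_succ_eq_sum _ _ _ _ (by omega), eulerianFirst_succ_eq_sum _ _ _ _ (by omega),
    eulerianFirst, Finset.mul_sum, ← Finset.sum_add_distrib]
  refine Finset.sum_congr rfl fun τ _ => ?_
  split_ifs <;> first | omega | ring

/-- Iterating the difference equation in p down to first value 0 produces binomial coefficients by
Pascal's rule. -/
theorem eulerianFirst_eq_sum (p : ℕ) : ∀ n, p ≤ n → eulerianFirst s t n p =
    ∑ k ∈ range (n + 1), (p.choose k : R) * (t - s) ^ k * eulerianFirst s t (n - k) 0 := by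
  induction p with
  | zero =>
    intro n _
    rw [Finset.sum_range_succ']
    simp
  | succ p ih =>
    intro n hn
    obtain ⟨n, rfl⟩ : ∃ m, n = m + 1 := ⟨n - 1, by omega⟩
    rw [eulerianFirst_succ_succ _ _ _ _ (by omega), ih (n + 1) (by omega), ih n (by omega),
      Finset.sum_range_succ', Finset.sum_range_succ' _ (n + 1), add_right_comm, Finset.mul_sum,
      ← Finset.sum_add_distrib]
    congr 1
    · refine Finset.sum_congr rfl fun k _ => ?_
      rw [Nat.choose_succ_succ, Nat.add_sub_add_right]
      push_cast
      ring
    · simp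

/-- Summation over the first value turns `p.choose k` into `(n + 1).choose (k + 1)` by the
hockey-stick identity. -/
theorem eulerian_succ_eq_sum (n : ℕ) : eulerian s t (n + 1) =
    ∑ k ∈ range (n + 1),
      ((n + 1).choose (k + 1) : R) * (t - s) ^ k * eulerianFirst s t (n - k) 0 := by
  have h : ∀ q ≤ n + 1, ∑ p ∈ range q, eulerianFirst s t n p = ∑ k ∈ range (n + 1),
      (q.choose (k + 1) : R) * (t - s) ^ k * eulerianFirst s t (n - k) 0 := fun q => by
    induction q with
    | zero => simp
    | succ q ih =>
      intro hq
      rw [Finset.sum_range_succ, ih (by omega), eulerianFirst_eq_sum s t q n (by omega),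
        ← Finset.sum_add_distrib]
      refine Finset.sum_congr rfl fun k _ => ?_
      rw [Nat.choose_succ_succ]
      push_cast
      ring
  rw [← sum_eulerianFirst, h _ le_rfl]

/-! ### Functional equation and closed form of the Eulerian series. -/

variable [Algebra ℚ R]

/-- The numbers `eulerianFirst s t m 0` have exponential generating function 1 + s f, because a
leading minimum is always followed by a rise. The preceding binomial sum is then a product of
exponential generating functions. -/
theorem eulerianSeries_eq : eulerianSeries s t =
    dividedExp (t - s) + PowerSeries.C s * eulerianSeries s t * dividedExp (t - s) := by
  have h : eulerianSeries s t = dividedExp (t - s) * (1 + PowerSeries.C s * eulerianSeries s t) := by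
    have ha : ∀ m, PowerSeries.coeff m (1 + PowerSeries.C s * eulerianSeries s t) =
        algebraMap ℚ R (1 / (m.factorial : ℚ)) * eulerianFirst s t m 0 := fun m => by
      rw [map_add, PowerSeries.coeff_C_mul, eulerianSeries, PowerSeries.coeff_mk,
        PowerSeries.coeff_one]
      rcases m with _ | m
      · simp [eulerianFirst_zero_zero]
      · rw [eulerianFirst_succ_zero]
        simp only [Nat.succ_ne_zero, if_false]
        ring
    ext n
    rw [PowerSeries.coeff_mul, Finset.Nat.sum_antidiagonal_eq_sum_range_succ_mk]
    rcases n with _ | n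
    · simp [eulerianSeries, dividedExp]
    · rw [Finset.sum_range_succ']
      simp only [ha]
      simp only [eulerianSeries, dividedExp, PowerSeries.coeff_mk, Nat.succ_ne_zero, if_false,
        if_true, zero_mul, add_zero, Nat.add_sub_add_right, Nat.add_sub_cancel]
      rw [eulerian_succ_eq_sum, Finset.mul_sum]
      refine Finset.sum_congr rfl fun k hk => ?_
      have hk' := Finset.mem_range.1 hk
      have := choose_mul_inv_factorial (R := R) (k + 1) (n - k)
      rw [show k + 1 + (n - k) = n + 1 by omega] at this
      linear_combination ((t - s) ^ k * eulerianFirst s t (n - k) 0) * this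
  nth_rw 1 [h]
  ring

/-- Multiplying f = h (1 + s f) by (t-s) e^{sx} and using (t-s) h = e^{(t-s)x} - 1 gives (t-s) f
e^{sx} = (e^{tx} - e^{sx})(1 + s f), which rearranges to the claim. -/
theorem eulerianSeries_mul : eulerianSeries s t *
    (PowerSeries.C s * PowerSeries.rescale t (PowerSeries.exp R)
      - PowerSeries.C t * PowerSeries.rescale s (PowerSeries.exp R)) =
    PowerSeries.rescale s (PowerSeries.exp R) - PowerSeries.rescale t (PowerSeries.exp R) := by
  have h1 := eulerianSeries_eq s t
  have h2 := C_mul_dividedExp (t - s)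
  have h3 := PowerSeries.exp_mul_exp_eq_exp_add (A := R) (t - s) s
  rw [sub_add_cancel] at h3
  rw [map_sub] at h2
  generalize PowerSeries.rescale t (PowerSeries.exp R) = et at *
  generalize PowerSeries.rescale s (PowerSeries.exp R) = es at *
  generalize PowerSeries.rescale (t - s) (PowerSeries.exp R) = e at *
  generalize eulerianSeries s t = f at *
  generalize dividedExp (t - s) = h at *
  generalize PowerSeries.C s = S at *
  generalize PowerSeries.C t = T at *
  linear_combination (-(T - S) * es) * h1 - (1 + S * f) * es * h2 - (1 + S * f) * h3

theorem eulerianSeries_zero_zero : eulerianSeries (0 : R) 0 = PowerSeries.X := by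
  rw [eulerianSeries_eq]
  ext n
  rcases n with _ | _ | n <;> simp [dividedExp, PowerSeries.coeff_X]

theorem eulerianSeries_one_zero : eulerianSeries (1 : R) 0 = PowerSeries.exp R - 1 := by
  have h := eulerianSeries_mul (1 : R) 0
  simpa using h

theorem eulerianSeries_one_neg_one : eulerianSeries (1 : R) (-1) *
      (PowerSeries.exp R + PowerSeries.rescale (-1) (PowerSeries.exp R)) =
    PowerSeries.exp R - PowerSeries.rescale (-1) (PowerSeries.exp R) := by
  have h := eulerianSeries_mul (1 : R) (-1)
  simp only [map_one, map_neg, one_mul, neg_mul, sub_neg_eq_add, PowerSeries.rescale_one,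
    RingHom.id_apply] at h
  rw [add_comm (PowerSeries.exp R)]
  exact h

theorem constantCoeff_eulerianSeries : PowerSeries.constantCoeff (eulerianSeries s t) = 0 := by
  rw [← PowerSeries.coeff_zero_eq_constantCoeff_apply]
  simp [eulerianSeries]

theorem coeff_one_eulerianSeries : PowerSeries.coeff 1 (eulerianSeries s t) = 1 := by
  simp [eulerianSeries, eulerian_succ_eq_sum, eulerianFirst_zero_zero]

end Eulerian

/-! ### The basis `Y^I` of noncommutative symmetric functions -/

section Noncommutative

variable {R : Type*} [CommRing R]

theorem complete_pos (n : ℕ+) : complete R (n : ℕ) = FreeAlgebra.ι R n := by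
  rw [complete, dif_pos n.pos]
  rfl

theorem coeff_sigma_sub_one_pos (n : ℕ+) :
    PowerSeries.coeff (n : ℕ) (sigma R - 1) = FreeAlgebra.ι R n := by
  rw [map_sub, sigma, PowerSeries.coeff_mk, complete_pos, PowerSeries.coeff_one, if_neg n.ne_zero,
    sub_zero]

theorem constantCoeff_sigma_sub_one : PowerSeries.constantCoeff (sigma R - 1) = 0 := by
  rw [← PowerSeries.coeff_zero_eq_constantCoeff_apply, map_sub, sigma, PowerSeries.coeff_mk]
  simp [complete]

/-- The algebra homomorphism sending `S_n` to the component of degree `n` of `u`. -/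
def liftSeries {A : Type*} [Ring A] [Algebra R A] (u : PowerSeries A) : NSym R →ₐ[R] A :=
  FreeAlgebra.lift R fun n : ℕ+ => PowerSeries.coeff (n : ℕ) u

theorem map_liftSeries {A : Type*} [Ring A] [Algebra R A] {u : PowerSeries A}
    (hu : PowerSeries.constantCoeff u = 0) :
    PowerSeries.map (liftSeries (R := R) u : NSym R →+* A) (sigma R - 1) = u := by
  ext n
  rw [PowerSeries.coeff_map]
  rcases Nat.eq_zero_or_pos n with rfl | hn
  · rw [PowerSeries.coeff_zero_eq_constantCoeff_apply, constantCoeff_sigma_sub_one, map_zero,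
      PowerSeries.coeff_zero_eq_constantCoeff_apply, hu]
  · lift n to ℕ+ using hn
    rw [coeff_sigma_sub_one_pos, RingHom.coe_coe, liftSeries, FreeAlgebra.lift_ι_apply]

theorem algHom_eq_liftSeries {A : Type*} [Ring A] [Algebra R A] (F : NSym R →ₐ[R] A) :
    F = liftSeries (PowerSeries.map (F : NSym R →+* A) (sigma R - 1)) := by
  refine FreeAlgebra.hom_ext (funext fun n => ?_)
  simp only [Function.comp_apply, liftSeries, FreeAlgebra.lift_ι_apply, PowerSeries.coeff_map,
    coeff_sigma_sub_one_pos, RingHom.coe_coe]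

/-- The coefficients of σ - 1 in positive degree are the free generators, so homomorphisms can be
compared on a single series. -/
theorem algHom_ext_sigma {A : Type*} [Ring A] [Algebra R A] {F G : NSym R →ₐ[R] A}
    (h : PowerSeries.map (F : NSym R →+* A) (sigma R - 1) =
      PowerSeries.map (G : NSym R →+* A) (sigma R - 1)) : F = G := by
  rw [algHom_eq_liftSeries F, h, ← algHom_eq_liftSeries]

/-- The basis `S^I`. -/
def sBasis (R : Type*) [CommRing R] : Module.Basis (List ℕ+) R (NSym R) :=
  (FreeAlgebra.basisFreeMonoid R ℕ+).reindex FreeMonoid.toList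

theorem sBasis_apply (I : List ℕ+) : sBasis R I = (I.map (FreeAlgebra.ι R)).prod := by
  rw [sBasis, Module.Basis.reindex_apply]
  have : FreeAlgebra.basisFreeMonoid R ℕ+ (FreeMonoid.toList.symm I) =
      FreeAlgebra.equivMonoidAlgebraFreeMonoid.symm
        (MonoidAlgebra.single (FreeMonoid.toList.symm I) 1) := rfl
  rw [this]
  simp [FreeAlgebra.equivMonoidAlgebraFreeMonoid, FreeMonoid.lift_apply]

theorem sBasis_nil : sBasis R [] = 1 := by
  simp [sBasis_apply]

theorem sBasis_cons (a : ℕ+) (I : List ℕ+) :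
    sBasis R (a :: I) = FreeAlgebra.ι R a * sBasis R I := by
  simp [sBasis_apply]

/-- The weight of a composition. -/
def weight (I : List ℕ+) : ℕ := (I.map fun i : ℕ+ => (i : ℕ)).sum

theorem weight_cons (a : ℕ+) (I : List ℕ+) : weight (a :: I) = a + weight I := by
  simp [weight]

theorem weight_append (I J : List ℕ+) : weight (I ++ J) = weight I + weight J := by
  simp [weight]

theorem finite_weight_le (d : ℕ) : {I : List ℕ+ | weight I ≤ d}.Finite := by
  have hlen : ∀ I : List ℕ+, I.length ≤ weight I := fun I => by
    induction I with
    | nil => simp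
    | cons a I ih =>
      rw [weight_cons, List.length_cons]
      have := a.pos
      omega
  have hmem : ∀ I : List ℕ+, ∀ a ∈ I, (a : ℕ) ≤ weight I := fun I a ha =>
    List.single_le_sum (by simp) _ (List.mem_map_of_mem ha)
  have hfin : {a : ℕ+ | (a : ℕ) ≤ d}.Finite :=
    (Set.finite_Iic d).preimage PNat.coe_injective.injOn
  have : Finite {a : ℕ+ // (a : ℕ) ≤ d} := hfin
  refine ((List.finite_length_le {a : ℕ+ // (a : ℕ) ≤ d} d).image (List.map Subtype.val)).subset
    fun I hI => ?_
  have hI' : weight I ≤ d := hI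
  lift I to List {a : ℕ+ // (a : ℕ) ≤ d} using fun a ha => (hmem I a ha).trans hI'
  refine ⟨I, ?_, rfl⟩
  have := (hlen _).trans hI'
  rwa [List.length_map] at this

/-- The homogeneous noncommutative symmetric functions of degree `n`. -/
def homogeneous (R : Type*) [CommRing R] (n : ℕ) : Submodule R (NSym R) :=
  Submodule.span R (sBasis R '' {I | weight I = n})

theorem mem_homogeneous {n : ℕ} {x : NSym R} :
    x ∈ homogeneous R n ↔ ∀ I, (sBasis R).repr x I ≠ 0 → weight I = n := by
  rw [homogeneous, Module.Basis.mem_span_image]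
  simp [Set.subset_def]

theorem sBasis_mem_homogeneous (I : List ℕ+) : sBasis R I ∈ homogeneous R (weight I) :=
  Submodule.subset_span ⟨I, rfl, rfl⟩

theorem one_mem_homogeneous : (1 : NSym R) ∈ homogeneous R 0 := by
  rw [← sBasis_nil]
  exact sBasis_mem_homogeneous []

theorem mul_mem_homogeneous {m n : ℕ} {x y : NSym R} (hx : x ∈ homogeneous R m)
    (hy : y ∈ homogeneous R n) : x * y ∈ homogeneous R (m + n) := by
  have h : homogeneous R m * homogeneous R n ≤ homogeneous R (m + n) := by
    rw [homogeneous, homogeneous, Submodule.span_mul_span, Submodule.span_le]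
    rintro _ ⟨_, ⟨I, hI, rfl⟩, _, ⟨J, hJ, rfl⟩, rfl⟩
    refine Submodule.subset_span ⟨I ++ J, ?_, ?_⟩
    · rw [Set.mem_ofPred_eq, weight_append, hI, hJ]
    · simp [sBasis_apply]
  exact h (Submodule.mul_mem_mul hx hy)

theorem coeff_pow_mem_homogeneous {u : PowerSeries (NSym R)}
    (hu : ∀ n, PowerSeries.coeff n u ∈ homogeneous R n) (k : ℕ) :
    ∀ n, PowerSeries.coeff n (u ^ k) ∈ homogeneous R n := by
  induction k with
  | zero =>
    intro n
    rw [pow_zero, PowerSeries.coeff_one]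
    split_ifs with h
    · rw [h]
      exact one_mem_homogeneous
    · exact zero_mem _
  | succ k ih =>
    intro n
    rw [pow_succ, PowerSeries.coeff_mul]
    refine sum_mem fun p hp => ?_
    rw [← Finset.HasAntidiagonal.mem_antidiagonal.1 hp]
    exact mul_mem_homogeneous (ih _) (hu _)

theorem coeff_compose_mem_homogeneous (g : PowerSeries R) {u : PowerSeries (NSym R)}
    (hu : ∀ n, PowerSeries.coeff n u ∈ homogeneous R n) (n : ℕ) :
    PowerSeries.coeff n (compose g u) ∈ homogeneous R n := by
  rw [compose, PowerSeries.coeff_mk]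
  exact sum_mem fun k _ => Submodule.smul_mem _ _ (coeff_pow_mem_homogeneous hu k n)

theorem coeff_sigma_sub_one_mem_homogeneous (n : ℕ) :
    PowerSeries.coeff n (sigma R - 1) ∈ homogeneous R n := by
  rcases Nat.eq_zero_or_pos n with rfl | hn
  · rw [PowerSeries.coeff_zero_eq_constantCoeff_apply, constantCoeff_sigma_sub_one]
    exact zero_mem _
  · lift n to ℕ+ using hn
    rw [coeff_sigma_sub_one_pos]
    simpa [sBasis_apply, weight] using sBasis_mem_homogeneous (R := R) [n]

theorem liftSeries_mem_homogeneous {u : PowerSeries (NSym R)}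
    (hu : ∀ n, PowerSeries.coeff n u ∈ homogeneous R n) (I : List ℕ+) :
    liftSeries u (sBasis R I) ∈ homogeneous R (weight I) := by
  induction I with
  | nil =>
    rw [sBasis_nil, map_one]
    exact one_mem_homogeneous
  | cons a I ih =>
    rw [sBasis_cons, map_mul, weight_cons, liftSeries, FreeAlgebra.lift_ι_apply]
    exact mul_mem_homogeneous (hu a) ih

/-! ### The series Y and the automorphism sending S_n to Y_n. -/

variable [Algebra ℚ R] (s t : R)

/-- `Y = f(φ)`. -/
def ySeries : PowerSeries (NSym R) := compose (eulerianSeries s t) (phi R)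

theorem coeff_ySeries (n : ℕ) : PowerSeries.coeff n (ySeries s t) = yGen s t n := rfl

theorem constantCoeff_ySeries : PowerSeries.constantCoeff (ySeries s t) = 0 :=
  constantCoeff_compose (constantCoeff_eulerianSeries s t) _

theorem yGen_zero : yGen s t 0 = 0 := by
  rw [← coeff_ySeries, PowerSeries.coeff_zero_eq_constantCoeff_apply, constantCoeff_ySeries]

/-- The compositional inverse of the Eulerian series. -/
def eulerianInv : PowerSeries R :=
  (eulerianSeries s t).substInvOfIsUnit (by rw [coeff_one_eulerianSeries]; exact isUnit_one)

theorem constantCoeff_eulerianInv : PowerSeries.constantCoeff (eulerianInv s t) = 0 :=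
  PowerSeries.constantCoeff_substInvOfIsUnit _ _

/-- The series which expresses `σ - 1` in terms of `Y`. -/
def yInvSeries (u : PowerSeries (NSym R)) : PowerSeries (NSym R) :=
  compose (PowerSeries.exp R - 1) (compose (eulerianInv s t) u)

theorem yInvSeries_ySeries : yInvSeries s t (ySeries s t) = sigma R - 1 := by
  have hv := constantCoeff_sigma_sub_one (R := R)
  have hphi : PowerSeries.constantCoeff (phi R) = 0 :=
    constantCoeff_compose PowerSeries.constantCoeff_log _
  rw [yInvSeries, ySeries, compose_compose hphi _ (constantCoeff_eulerianSeries s t), eulerianInv,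
    PowerSeries.subst_substInvOfIsUnit_left _ (constantCoeff_eulerianSeries s t), compose_X hphi,
    phi, compose_compose hv _ PowerSeries.constantCoeff_log, exp_sub_one_subst_log, compose_X hv]

theorem constantCoeff_yInvSeries (u : PowerSeries (NSym R)) :
    PowerSeries.constantCoeff (yInvSeries s t u) = 0 :=
  constantCoeff_compose (by simp) _

theorem compose_log_yInvSeries {u : PowerSeries (NSym R)} (hu : PowerSeries.constantCoeff u = 0) :
    compose (eulerianSeries s t) (compose (PowerSeries.log R) (yInvSeries s t u)) = u := by
  have h1 : PowerSeries.constantCoeff (compose (eulerianInv s t) u) = 0 :=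
    constantCoeff_compose (constantCoeff_eulerianInv s t) _
  rw [yInvSeries, compose_compose h1 _ (by simp), log_subst_exp_sub_one, compose_X h1,
    compose_compose hu _ (constantCoeff_eulerianInv s t), eulerianInv,
    PowerSeries.subst_substInvOfIsUnit_right _ (constantCoeff_eulerianSeries s t), compose_X hu]

/-- The automorphism of the algebra of noncommutative symmetric functions with `S_n ↦ Y_n`. -/
def yEquiv : NSym R ≃ₐ[R] NSym R :=
  AlgEquiv.ofAlgHom (liftSeries (ySeries s t)) (liftSeries (yInvSeries s t (sigma R - 1)))
    -- Homomorphisms commute with `compose`, so on σ - 1 the two composites of the maps reduce to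
    -- the two composites of f ∘ log with its inverse series.
    (algHom_ext_sigma (by
      rw [AlgHom.comp_toRingHom, PowerSeries.map_comp, RingHom.comp_apply,
        map_liftSeries (constantCoeff_yInvSeries s t _), yInvSeries, map_compose, map_compose,
        map_liftSeries (constantCoeff_ySeries s t)]
      change yInvSeries s t (ySeries s t) = _
      rw [yInvSeries_ySeries]
      ext n
      rw [PowerSeries.coeff_map]
      rfl))
    (algHom_ext_sigma (by
      rw [AlgHom.comp_toRingHom, PowerSeries.map_comp, RingHom.comp_apply,
        map_liftSeries (constantCoeff_ySeries s t), ySeries, map_compose, phi, map_compose,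
        map_liftSeries (constantCoeff_yInvSeries s t _),
        compose_log_yInvSeries s t constantCoeff_sigma_sub_one]
      ext n
      rw [PowerSeries.coeff_map]
      rfl))

theorem yEquiv_ι (n : ℕ+) : yEquiv s t (FreeAlgebra.ι R n) = yGen s t n :=
  FreeAlgebra.lift_ι_apply _ _

/-- The basis `Y^I`. -/
def yBasis : Module.Basis (List ℕ+) R (NSym R) := (sBasis R).map (yEquiv s t).toLinearEquiv

theorem yMul_nil : yMul s t [] = 1 := by
  simp [yMul]

theorem yMul_cons (a : ℕ+) (I : List ℕ+) : yMul s t (a :: I) = yGen s t a * yMul s t I := by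
  simp [yMul]

theorem yBasis_apply (I : List ℕ+) : yBasis s t I = yMul s t I := by
  induction I with
  | nil => rw [yBasis, Module.Basis.map_apply, AlgEquiv.toLinearEquiv_apply, sBasis_nil, map_one,
      yMul_nil]
  | cons a I ih =>
    rw [yBasis, Module.Basis.map_apply, AlgEquiv.toLinearEquiv_apply] at ih ⊢
    rw [sBasis_cons, map_mul, ih, yEquiv_ι, yMul_cons]

theorem yMul_mem_homogeneous (I : List ℕ+) : yMul s t I ∈ homogeneous R (weight I) := by
  rw [← yBasis_apply]
  exact liftSeries_mem_homogeneous (coeff_compose_mem_homogeneous _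
    (coeff_compose_mem_homogeneous _ coeff_sigma_sub_one_mem_homogeneous)) I

/-- The Y-coordinates of S^I are the S-coordinates of its image under the inverse automorphism,
which is again graded. -/
theorem weight_eq_of_yBasis_repr_ne_zero {I J : List ℕ+}
    (h : (yBasis s t).repr (sBasis R I) J ≠ 0) : weight J = weight I := by
  have hm : (yEquiv s t).symm (sBasis R I) ∈ homogeneous R (weight I) :=
    liftSeries_mem_homogeneous (coeff_compose_mem_homogeneous _
      (coeff_compose_mem_homogeneous _ coeff_sigma_sub_one_mem_homogeneous)) I
  exact mem_homogeneous.1 hm J h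

theorem yGen_mul_yBasis (c : ℕ+) (I : List ℕ+) :
    yGen s t c * yBasis s t I = yBasis s t (c :: I) := by
  rw [yBasis_apply, yBasis_apply, yMul_cons]

theorem yBasis_repr_yGen_mul_nil (c : ℕ+) (x : NSym R) :
    (yBasis s t).repr (yGen s t c * x) [] = 0 := by
  classical
  have h : (yBasis s t).coord [] ∘ₗ LinearMap.mulLeft R (yGen s t c) = 0 :=
    (yBasis s t).ext fun I => by simp [yGen_mul_yBasis, Module.Basis.repr_self]
  exact LinearMap.congr_fun h x

theorem yBasis_repr_yGen_mul_cons (c a : ℕ+) (u : List ℕ+) (x : NSym R) :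
    (yBasis s t).repr (yGen s t c * x) (a :: u) = if a = c then (yBasis s t).repr x u else 0 := by
  classical
  have h : (yBasis s t).coord (a :: u) ∘ₗ LinearMap.mulLeft R (yGen s t c) =
      if a = c then (yBasis s t).coord u else 0 :=
    (yBasis s t).ext fun I => by
      split_ifs with hac
      · simp [yGen_mul_yBasis, Module.Basis.repr_self, Finsupp.single_apply, hac]
      · simp [yGen_mul_yBasis, Module.Basis.repr_self, Ne.symm hac]
  have h' := LinearMap.congr_fun h x
  split_ifs with hac
  · rwa [if_pos hac] at h'
  · rwa [if_neg hac] at h'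

end Noncommutative

/-! ### Quasi-symmetric functions as functionals on noncommutative symmetric functions -/

section QuasiSymmetric

/-- The exponent of `x_0 ^ {l_0} x_1 ^ {l_1} ⋯`. -/
def listExponent (l : List ℕ) : ℕ →₀ ℕ := l.toFinsupp

theorem listExponent_apply (l : List ℕ) (i : ℕ) : listExponent l i = l.getD i 0 := rfl

theorem exponent_eq_listExponent (I : List ℕ+) :
    exponent I = listExponent (I.map fun i : ℕ+ => (i : ℕ)) := by
  ext i
  rw [exponent, List.toFinsupp_apply, listExponent_apply]
  congr 1
  induction I with
  | nil => rfl
  | cons a I ih => simpa using ih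

/-- The order embedding of `ℕ` which omits the value `k`. -/
def skip (k : ℕ) : ℕ ↪o ℕ :=
  OrderEmbedding.ofStrictMono (fun i => if i < k then i else i + 1) fun i j h => by
    simp only
    split_ifs <;> omega

theorem skip_apply (k i : ℕ) : skip k i = if i < k then i else i + 1 := rfl

/-- Inserting a zero exponent is a strictly increasing relabelling of the variables, which
quasi-symmetric coefficients do not see. -/
theorem embDomain_skip_listExponent (l₁ l₂ : List ℕ) :
    (listExponent (l₁ ++ l₂)).embDomain (skip l₁.length).toEmbedding =
      listExponent (l₁ ++ 0 :: l₂) := by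
  ext i
  rcases lt_trichotomy i l₁.length with h | h | h
  · have hi : (skip l₁.length).toEmbedding i = i := by simp [skip_apply, h]
    nth_rw 1 [← hi]
    rw [Finsupp.embDomain_apply_self, listExponent_apply, listExponent_apply]
    simp [List.getD_eq_getElem?_getD, List.getElem?_append, h]
  · rw [Finsupp.embDomain_of_notMem_range]
    · rw [listExponent_apply]
      simp [List.getD_eq_getElem?_getD, h]
    · rintro ⟨j, hj⟩
      simp only [RelEmbedding.coe_toEmbedding, skip_apply] at hj
      split_ifs at hj <;> omega
  · obtain ⟨j, rfl⟩ : ∃ j, i = j + 1 := ⟨i - 1, by omega⟩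
    have hi : (skip l₁.length).toEmbedding j = j + 1 := by
      simp only [RelEmbedding.coe_toEmbedding, skip_apply]
      rw [if_neg (by omega)]
    nth_rw 1 [← hi]
    rw [Finsupp.embDomain_apply_self, listExponent_apply, listExponent_apply]
    simp only [List.getD_eq_getElem?_getD, List.getElem?_append]
    rw [if_neg (by omega), if_neg (by omega), Nat.sub_add_comm (by omega), List.getElem?_cons_succ]

theorem listExponent_range_map (m : ℕ →₀ ℕ) {N : ℕ} (h : ∀ i, N ≤ i → m i = 0) :
    listExponent ((List.range N).map m) = m := by
  ext i
  rw [listExponent_apply, List.getD_eq_getElem?_getD]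
  rcases lt_or_ge i N with hi | hi
  · simp [hi]
  · simp [hi, h i hi]

/-- The composition formed by the nonzero values of an exponent. -/
def composition (m : ℕ →₀ ℕ) : List ℕ+ :=
  m.support.sort.map fun i => (m i).toPNat'

theorem composition_embDomain (g : ℕ ↪o ℕ) (m : ℕ →₀ ℕ) :
    composition (m.embDomain g.toEmbedding) = composition m := by
  rw [composition, composition, Finsupp.support_embDomain,
    ← Finset.map_sort g.toEmbedding m.support (· ≤ ·) (· ≤ ·) (fun a _ b _ => g.le_iff_le.symm),
    List.map_map]
  refine List.map_congr_left fun i _ => ?_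
  rw [Function.comp_apply, Finsupp.embDomain_apply_self]

theorem composition_exponent (I : List ℕ+) : composition (exponent I) = I := by
  have hs : (exponent I).support = range I.length := by
    ext i
    rw [Finsupp.mem_support_iff, Finset.mem_range, exponent_eq_listExponent, listExponent_apply,
      List.getD_eq_getElem?_getD]
    by_cases h : i < I.length
    · simp [h]
    · simp [h]
  rw [composition, hs, Finset.sort_range]
  refine List.ext_getElem (by simp) fun i h1 h2 => ?_
  rw [List.getElem_map, List.getElem_range, exponent_eq_listExponent, listExponent_apply,
    List.getD_eq_getElem?_getD]
  simp [h2]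

theorem weight_composition (m : ℕ →₀ ℕ) : weight (composition m) = m.degree := by
  rw [weight, composition, List.map_map, Finsupp.degree_apply, ← Finset.sum_map_toList,
    ← ((Finset.sort_perm_toList m.support (· ≤ ·)).map m).sum_eq]
  congr 1
  refine List.map_congr_left fun i hi => ?_
  have hi' : m i ≠ 0 := Finsupp.mem_support_iff.1 ((Finset.mem_sort _).1 hi)
  simp [Nat.pos_of_ne_zero hi']

theorem degree_exponent (I : List ℕ+) : (exponent I).degree = weight I := by
  rw [← weight_composition, composition_exponent]

variable {R : Type*} [CommRing R]

theorem pairing_sBasis (F : QSym R) (I : List ℕ+) :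
    pairing F (sBasis R I) = MvPowerSeries.coeff (exponent I) (F : MvPowerSeries ℕ R) := by
  rw [sBasis, Module.Basis.reindex_apply, pairing, Module.Basis.constr_basis]
  rfl

theorem pairing_add (F G : QSym R) : pairing (F + G) = pairing F + pairing G :=
  (sBasis R).ext fun I => by simp [pairing_sBasis]

theorem pairing_smul (r : R) (F : QSym R) : pairing (r • F) = r • pairing F :=
  (sBasis R).ext fun I => by simp [pairing_sBasis]

/-- The product `S_{l_0} S_{l_1} ⋯`, where `S_0 = 1`. -/
def completeProd (R : Type*) [CommRing R] (l : List ℕ) : NSym R := (l.map (complete R)).prod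

theorem completeProd_cons (n : ℕ) (l : List ℕ) :
    completeProd R (n :: l) = complete R n * completeProd R l := by
  simp [completeProd]

theorem completeProd_eq_sBasis (I : List ℕ+) :
    completeProd R (I.map fun i : ℕ+ => (i : ℕ)) = sBasis R I := by
  rw [completeProd, sBasis_apply, List.map_map]
  congr 1
  exact List.map_congr_left fun a _ => complete_pos a

/-- Zero entries are harmless on both sides: S_0 = 1 in the product, and quasi-symmetry in the
coefficient. This gives access to coefficients of all monomials, including those with gaps. -/
theorem pairing_completeProd (F : QSym R) (l : List ℕ) : pairing F (completeProd R l) =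
    MvPowerSeries.coeff (listExponent l) (F : MvPowerSeries ℕ R) := by
  -- The prefix I collects the positive entries already read; a zero is deleted, a positive entry is
  -- appended to I.
  have h : ∀ (l : List ℕ) (I : List ℕ+), pairing F (sBasis R I * completeProd R l) =
      MvPowerSeries.coeff (listExponent ((I.map fun i : ℕ+ => (i : ℕ)) ++ l))
        (F : MvPowerSeries ℕ R) := fun l => by
    induction l with
    | nil =>
      intro I
      rw [completeProd, List.map_nil, List.prod_nil, mul_one, pairing_sBasis,
        exponent_eq_listExponent, List.append_nil]
    | cons n l ih =>
      intro I
      rw [completeProd_cons]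
      rcases Nat.eq_zero_or_pos n with rfl | hn
      · rw [← embDomain_skip_listExponent, F.2.1, ← ih]
        simp [complete]
      · lift n to ℕ+ using hn
        rw [complete_pos, ← mul_assoc]
        have := ih (I ++ [n])
        rw [List.map_append, List.append_assoc] at this
        simp only [List.map_cons, List.map_nil, List.cons_append, List.nil_append] at this
        rw [← this]
        simp [sBasis_apply]
  have := h l []
  rwa [sBasis_nil, one_mul, List.map_nil, List.nil_append] at this

theorem pairing_injective : Function.Injective (pairing : QSym R → NSym R →ₗ[R] R) := by
  intro F G h
  refine Subtype.ext (MvPowerSeries.ext fun m => ?_)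
  obtain ⟨N, hN⟩ : ∃ N, ∀ i, N ≤ i → m i = 0 := by
    refine ⟨m.support.sup id + 1, fun i hi => ?_⟩
    by_contra hne
    have := Finset.le_sup (f := id) (Finsupp.mem_support_iff.2 hne)
    simp only [id] at this
    omega
  rw [← listExponent_range_map m hN, ← pairing_completeProd, h, pairing_completeProd]

theorem pairing_eq_zero_of_mem_homogeneous {F : QSym R} {d n : ℕ}
    (hd : ∀ m : ℕ →₀ ℕ, d < m.degree → MvPowerSeries.coeff m (F : MvPowerSeries ℕ R) = 0)
    (hn : d < n) {x : NSym R} (hx : x ∈ homogeneous R n) : pairing F x = 0 := by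
  rw [homogeneous] at hx
  induction hx using Submodule.span_induction with
  | mem x hx =>
    obtain ⟨I, hI, rfl⟩ := hx
    have hI' : weight I = n := hI
    rw [pairing_sBasis, hd _ (by rw [degree_exponent, hI']; exact hn)]
  | zero => exact map_zero _
  | add x y _ _ hx hy => rw [map_add, hx, hy, add_zero]
  | smul r x _ hx => rw [map_smul, hx, smul_zero]

/-- A functional which vanishes in large degrees is the pairing with a quasi-symmetric function. -/
theorem exists_pairing_eq (L : NSym R →ₗ[R] R) (d : ℕ)
    (hL : ∀ I, d < weight I → L (sBasis R I) = 0) : ∃ F : QSym R, pairing F = L := by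
  -- This is the sum of L(S^I) M_I; its coefficients depend only on the composition underlying the
  -- exponent.
  let F : MvPowerSeries ℕ R := fun m => L (sBasis R (composition m))
  have hF : ∀ m, MvPowerSeries.coeff m F = L (sBasis R (composition m)) := fun m => rfl
  refine ⟨⟨F, fun g m => ?_, d, fun m hm => ?_⟩, (sBasis R).ext fun I => ?_⟩
  · rw [hF, hF, composition_embDomain]
  · rw [hF, hL _ (by rwa [weight_composition])]
  · rw [pairing_sBasis]
    change MvPowerSeries.coeff _ F = _
    rw [hF, composition_exponent]

/-! ### The basis of quasi-symmetric functions dual to Y^I. -/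

variable [Algebra ℚ R] (s t : R)

theorem finite_support_pairing_yMul (F : QSym R) :
    (Function.support fun K => pairing F (yMul s t K)).Finite := by
  obtain ⟨d, hd⟩ := F.2.2
  refine (finite_weight_le d).subset fun K hK => ?_
  by_contra hlt
  exact hK (pairing_eq_zero_of_mem_homogeneous hd (not_le.1 hlt) (yMul_mem_homogeneous s t K))

/-- The coordinates `⟨F, Y^K⟩` of a quasi-symmetric function. -/
def yCoordinates : QSym R →ₗ[R] List ℕ+ →₀ R where
  toFun F := Finsupp.ofSupportFinite (fun K => pairing F (yMul s t K))
    (finite_support_pairing_yMul s t F)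
  map_add' F G := by
    ext K
    simp [Finsupp.ofSupportFinite_coe, pairing_add]
  map_smul' r F := by
    ext K
    simp [Finsupp.ofSupportFinite_coe, pairing_smul]

theorem yCoordinates_apply (F : QSym R) (K : List ℕ+) :
    yCoordinates s t F K = pairing F (yMul s t K) := rfl

theorem yCoordinates_bijective : Function.Bijective (yCoordinates s t) := by
  constructor
  · intro F G h
    refine pairing_injective ((yBasis s t).ext fun K => ?_)
    rw [yBasis_apply, ← yCoordinates_apply, h, yCoordinates_apply]
  · intro c
    -- The functional Y^J ↦ c_J kills S^I once the weight of I exceeds all weights in the support of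
    -- c, because S^I involves only Y^J of its own weight.
    obtain ⟨F, hF⟩ := exists_pairing_eq ((yBasis s t).constr R c) (c.support.sup weight)
      fun I hI => by
        rw [Module.Basis.constr_apply]
        refine Finset.sum_eq_zero fun J hJ => ?_
        have hJ' := weight_eq_of_yBasis_repr_ne_zero s t (Finsupp.mem_support_iff.1 hJ)
        by_cases hc : c J = 0
        · simp only [hc, smul_zero]
        · have := Finset.le_sup (f := weight) (Finsupp.mem_support_iff.2 hc)
          omega
    refine ⟨F, Finsupp.ext fun K => ?_⟩
    rw [yCoordinates_apply, hF, ← yBasis_apply, Module.Basis.constr_basis]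

/-- The basis `X_I` of quasi-symmetric functions dual to `Y^I`. -/
def xBasis : Module.Basis (List ℕ+) R (QSym R) :=
  Module.Basis.ofRepr (LinearEquiv.ofBijective (yCoordinates s t) (yCoordinates_bijective s t))

theorem xBasis_repr_apply (F : QSym R) (K : List ℕ+) :
    (xBasis s t).repr F K = pairing F (yMul s t K) := rfl

theorem pairing_xBasis (I : List ℕ+) : pairing (xBasis s t I) = (yBasis s t).coord I := by
  classical
  refine (yBasis s t).ext fun K => ?_
  rw [yBasis_apply, ← xBasis_repr_apply, ← yBasis_apply, Module.Basis.coord_apply,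
    Module.Basis.repr_self, Module.Basis.repr_self, Finsupp.single_apply, Finsupp.single_apply]
  simp only [eq_comm]

theorem isDualFamily_xBasis : IsDualFamily (xBasis s t) (yMul s t) := fun I J => by
  rw [← xBasis_repr_apply, Module.Basis.repr_self, Finsupp.single_apply]

theorem eq_xBasis_of_isDualFamily {X : List ℕ+ → QSym R} (hX : IsDualFamily X (yMul s t)) :
    X = xBasis s t := by
  funext I
  refine (xBasis s t).repr.injective (Finsupp.ext fun J => ?_)
  rw [xBasis_repr_apply, xBasis_repr_apply, hX, isDualFamily_xBasis]

end QuasiSymmetric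

/-! ### Coefficients of the operators on words -/

section Words

variable {R : Type*} [CommRing R]

theorem prepend_apply_nil (a : ℕ+) (p : Words R) : prepend a p [] = 0 := by
  induction p using Finsupp.induction_linear with
  | zero => simp
  | add p q hp hq => rw [map_add, Finsupp.add_apply, hp, hq, add_zero]
  | single w r => simp [prepend]

theorem prepend_apply_cons (a c : ℕ+) (K : List ℕ+) (p : Words R) :
    prepend a p (c :: K) = if a = c then p K else 0 := by
  classical
  induction p using Finsupp.induction_linear with
  | zero => simp
  | add p q hp hq =>
    rw [map_add, Finsupp.add_apply, hp, hq, Finsupp.add_apply]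
    split_ifs <;> simp
  | single w r =>
    rw [prepend, Finsupp.linearCombination_single, Finsupp.smul_apply, Finsupp.single_apply,
      Finsupp.single_apply]
    by_cases h : a = c <;> simp [h]

theorem zeta_apply_nil (x : ℕ+) (p : Words R) : zeta x p [] = 0 := by
  induction p using Finsupp.induction_linear with
  | zero => simp
  | add p q hp hq => rw [map_add, Finsupp.add_apply, hp, hq, add_zero]
  | single w r => cases w <;> simp [zeta]

/-- The first letter c can only come from b = c - x. The guard is essential: subtraction in `ℕ+`
returns 1 when c ≤ x. -/
theorem zeta_apply_cons (x c : ℕ+) (K : List ℕ+) (p : Words R) :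
    zeta x p (c :: K) = if x < c then p ((c - x) :: K) else 0 := by
  classical
  induction p using Finsupp.induction_linear with
  | zero => simp
  | add p q hp hq =>
    rw [map_add, Finsupp.add_apply, hp, hq, Finsupp.add_apply]
    split_ifs <;> simp
  | single w r =>
    rw [zeta, Finsupp.linearCombination_single, Finsupp.smul_apply, Finsupp.single_apply]
    cases w with
    | nil => simp
    | cons b w =>
      simp only [Finsupp.single_apply, List.cons.injEq, smul_eq_mul, mul_ite, mul_one, mul_zero]
      have key : b + x = c ↔ x < c ∧ b = c - x := by
        constructor
        · rintro rfl
          exact ⟨PNat.lt_add_left x b, by rw [PNat.add_sub]⟩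
        · rintro ⟨h, rfl⟩
          rw [add_comm, PNat.add_sub_of_lt h]
      simp only [key]
      by_cases h : x < c <;> simp [h]

end Words

/-! ### The coproduct dual to the product of quasi-symmetric functions -/

section Coproduct

/-- The exponent with first entry `i` followed by the entries of `m`. -/
def consExponent (i : ℕ) (m : ℕ →₀ ℕ) : ℕ →₀ ℕ := Finsupp.single 0 i + m.mapDomain Nat.succ

theorem consExponent_zero (i : ℕ) (m : ℕ →₀ ℕ) : consExponent i m 0 = i := by
  rw [consExponent, Finsupp.add_apply, Finsupp.mapDomain_of_notMem_range]
  · simp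
  · simp

theorem consExponent_succ (i : ℕ) (m : ℕ →₀ ℕ) (k : ℕ) : consExponent i m (k + 1) = m k := by
  rw [consExponent, Finsupp.add_apply]
  have := Finsupp.mapDomain_apply Nat.succ_injective m k
  simpa using this

/-- The exponent which remains after the first entry has been removed. -/
def tailExponent (m : ℕ →₀ ℕ) : ℕ →₀ ℕ := m.comapDomain Nat.succ Nat.succ_injective.injOn

theorem tailExponent_apply (m : ℕ →₀ ℕ) (k : ℕ) : tailExponent m k = m (k + 1) := rfl

theorem consExponent_tailExponent (m : ℕ →₀ ℕ) : consExponent (m 0) (tailExponent m) = m := by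
  ext k
  cases k with
  | zero => rw [consExponent_zero]
  | succ k => rw [consExponent_succ, tailExponent_apply]

theorem tailExponent_consExponent (i : ℕ) (m : ℕ →₀ ℕ) : tailExponent (consExponent i m) = m := by
  ext k
  rw [tailExponent_apply, consExponent_succ]

theorem consExponent_add (i j : ℕ) (m m' : ℕ →₀ ℕ) :
    consExponent i m + consExponent j m' = consExponent (i + j) (m + m') := by
  ext k
  cases k <;> simp [consExponent_zero, consExponent_succ]

theorem listExponent_cons (n : ℕ) (l : List ℕ) :
    listExponent (n :: l) = consExponent n (listExponent l) := by
  ext k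
  cases k with
  | zero => rw [consExponent_zero]; rfl
  | succ k => rw [consExponent_succ]; rfl

/-- A factorization of a monomial splits independently into one of its first variable and one of the
rest; this matches Δ(S_n P) = Δ(S_n) Δ(P). -/
theorem sum_antidiagonal_consExponent {M : Type*} [AddCommMonoid M] (n : ℕ) (m : ℕ →₀ ℕ)
    (H : (ℕ →₀ ℕ) → (ℕ →₀ ℕ) → M) :
    ∑ p ∈ antidiagonal (consExponent n m), H p.1 p.2 =
      ∑ e ∈ antidiagonal n, ∑ q ∈ antidiagonal m,
        H (consExponent e.1 q.1) (consExponent e.2 q.2) := by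
  rw [← Finset.sum_product']
  refine Finset.sum_bij' (fun p _ => ((p.1 0, p.2 0), (tailExponent p.1, tailExponent p.2)))
    (fun x _ => (consExponent x.1.1 x.2.1, consExponent x.1.2 x.2.2)) ?_ ?_ ?_ ?_ ?_
  · rintro ⟨p, q⟩ h
    rw [Finset.HasAntidiagonal.mem_antidiagonal] at h
    simp only at h
    rw [Finset.mem_product, Finset.HasAntidiagonal.mem_antidiagonal,
      Finset.HasAntidiagonal.mem_antidiagonal]
    constructor
    · simpa [consExponent_zero] using DFunLike.congr_fun h 0
    · ext k
      simpa [consExponent_succ, tailExponent_apply] using DFunLike.congr_fun h (k + 1)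
  · rintro ⟨⟨i, j⟩, p, q⟩ h
    rw [Finset.mem_product, Finset.HasAntidiagonal.mem_antidiagonal,
      Finset.HasAntidiagonal.mem_antidiagonal] at h
    rw [Finset.HasAntidiagonal.mem_antidiagonal]
    simp only at h ⊢
    rw [consExponent_add, h.1, h.2]
  · intro p _
    simp only [consExponent_tailExponent]
  · intro x _
    simp only [consExponent_zero, tailExponent_consExponent]
  · intro p _
    simp only [consExponent_tailExponent]

variable (R : Type*) [CommRing R]

/-- `σ ⊗ 1 - 1`. -/
def leftSeries : PowerSeries (NSym R ⊗[R] NSym R) :=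
  PowerSeries.map ((Algebra.TensorProduct.includeLeft : NSym R →ₐ[R] NSym R ⊗[R] NSym R) :
    NSym R →+* NSym R ⊗[R] NSym R) (sigma R - 1)

/-- `1 ⊗ σ - 1`. -/
def rightSeries : PowerSeries (NSym R ⊗[R] NSym R) :=
  PowerSeries.map ((Algebra.TensorProduct.includeRight : NSym R →ₐ[R] NSym R ⊗[R] NSym R) :
    NSym R →+* NSym R ⊗[R] NSym R) (sigma R - 1)

theorem constantCoeff_leftSeries : PowerSeries.constantCoeff (leftSeries R) = 0 := by
  rw [leftSeries, ← PowerSeries.coeff_zero_eq_constantCoeff_apply, PowerSeries.coeff_map,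
    PowerSeries.coeff_zero_eq_constantCoeff_apply, constantCoeff_sigma_sub_one, map_zero]

theorem constantCoeff_rightSeries : PowerSeries.constantCoeff (rightSeries R) = 0 := by
  rw [rightSeries, ← PowerSeries.coeff_zero_eq_constantCoeff_apply, PowerSeries.coeff_map,
    PowerSeries.coeff_zero_eq_constantCoeff_apply, constantCoeff_sigma_sub_one, map_zero]

theorem commute_leftSeries_rightSeries : Commute (leftSeries R) (rightSeries R) := by
  ext n
  rw [PowerSeries.coeff_mul, PowerSeries.coeff_mul, ← Finset.Nat.sum_antidiagonal_swap]
  refine Finset.sum_congr rfl fun p _ => ?_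
  rw [leftSeries, rightSeries, PowerSeries.coeff_map, PowerSeries.coeff_map]
  generalize sigma R - 1 = v
  simp

/-- The coproduct, with `σ ↦ σ ⊗ σ`. -/
def coproduct : NSym R →ₐ[R] NSym R ⊗[R] NSym R :=
  liftSeries (leftSeries R + rightSeries R + leftSeries R * rightSeries R)

theorem map_coproduct_sigma_sub_one :
    PowerSeries.map (coproduct R : NSym R →+* NSym R ⊗[R] NSym R) (sigma R - 1) =
      leftSeries R + rightSeries R + leftSeries R * rightSeries R :=
  map_liftSeries (by
    rw [map_add, map_add, map_mul, constantCoeff_leftSeries, constantCoeff_rightSeries]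
    simp)

theorem coproduct_complete (n : ℕ) : coproduct R (complete R n) =
    ∑ p ∈ antidiagonal n, complete R p.1 ⊗ₜ[R] complete R p.2 := by
  have h : PowerSeries.map (coproduct R : NSym R →+* NSym R ⊗[R] NSym R) (sigma R) =
      (1 + leftSeries R) * (1 + rightSeries R) := by
    have := map_coproduct_sigma_sub_one R
    rw [map_sub, map_one, sub_eq_iff_eq_add] at this
    rw [this]
    noncomm_ring
  have h' := congrArg (PowerSeries.coeff n) h
  rw [PowerSeries.coeff_map, sigma, PowerSeries.coeff_mk, PowerSeries.coeff_mul] at h'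
  rw [RingHom.coe_coe] at h'
  rw [h']
  refine Finset.sum_congr rfl fun p _ => ?_
  rw [leftSeries, rightSeries, map_sub, map_sub, map_one, map_one, add_sub_cancel,
    add_sub_cancel, PowerSeries.coeff_map, PowerSeries.coeff_map, sigma, PowerSeries.coeff_mk,
    PowerSeries.coeff_mk]
  simp

/-- By multiplicativity every entry of l is split independently, so the terms correspond to the
factorizations of a monomial. Zero parts occur, hence lists over `ℕ` of fixed length. -/
theorem coproduct_completeProd (l : List ℕ) : coproduct R (completeProd R l) =
    ∑ p ∈ antidiagonal (listExponent l),
      completeProd R ((List.range l.length).map p.1) ⊗ₜ[R]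
        completeProd R ((List.range l.length).map p.2) := by
  induction l with
  | nil =>
    have h : listExponent [] = 0 := rfl
    rw [h, Finset.HasAntidiagonal.antidiagonal_zero, Finset.sum_singleton]
    simp [completeProd, Algebra.TensorProduct.one_def]
  | cons n l ih =>
    rw [completeProd_cons, map_mul, ih, coproduct_complete, listExponent_cons,
      sum_antidiagonal_consExponent n (listExponent l) fun p q =>
        completeProd R ((List.range (n :: l).length).map p) ⊗ₜ[R]
          completeProd R ((List.range (n :: l).length).map q), Finset.sum_mul_sum]
    refine Finset.sum_congr rfl fun e _ => Finset.sum_congr rfl fun q _ => ?_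
    rw [List.length_cons, List.range_succ_eq_map, List.map_cons, List.map_cons, List.map_map,
      List.map_map, completeProd_cons, completeProd_cons, consExponent_zero, consExponent_zero,
      Algebra.TensorProduct.tmul_mul_tmul]
    simp only [Function.comp_def, Nat.succ_eq_add_one, consExponent_succ]

variable {R}

/-- The tensor product of two functionals. -/
def tensorFunctional (L L' : NSym R →ₗ[R] R) : NSym R ⊗[R] NSym R →ₗ[R] R :=
  LinearMap.mul' R R ∘ₗ TensorProduct.map L L'

theorem tensorFunctional_tmul (L L' : NSym R →ₗ[R] R) (x y : NSym R) :
    tensorFunctional L L' (x ⊗ₜ[R] y) = L x * L' y := by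
  simp [tensorFunctional]

/-- The product of quasi-symmetric functions is dual to the coproduct. -/
theorem pairing_mul (F G : QSym R) (x : NSym R) :
    pairing (F * G) x = tensorFunctional (pairing F) (pairing G) (coproduct R x) := by
  classical
  have h : pairing (F * G) =
      tensorFunctional (pairing F) (pairing G) ∘ₗ (coproduct R).toLinearMap :=
    (sBasis R).ext fun I => by
      rw [LinearMap.comp_apply, AlgHom.toLinearMap_apply, ← completeProd_eq_sBasis,
        pairing_completeProd, coproduct_completeProd, map_sum]
      change MvPowerSeries.coeff _ ((F : MvPowerSeries ℕ R) * (G : MvPowerSeries ℕ R)) = _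
      rw [MvPowerSeries.coeff_mul]
      refine Finset.sum_congr rfl fun p hp => ?_
      rw [Finset.HasAntidiagonal.mem_antidiagonal] at hp
      -- Both factors of the monomial vanish beyond the length of I, so lists of that length recover
      -- them entirely.
      have hz : ∀ i, (I.map fun i : ℕ+ => (i : ℕ)).length ≤ i → p.1 i = 0 ∧ p.2 i = 0 :=
        fun i hi => by
          have := DFunLike.congr_fun hp i
          rw [listExponent_apply, List.getD_eq_default _ _ hi, Finsupp.add_apply] at this
          omega
      rw [tensorFunctional_tmul, pairing_completeProd, pairing_completeProd,
        listExponent_range_map _ fun i hi => (hz i hi).1,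
        listExponent_range_map _ fun i hi => (hz i hi).2]
  rw [h]
  rfl

/-! ### The coproduct in the basis Y^I and the product of the X_I. -/

variable [Algebra ℚ R] (s t : R)

theorem coproduct_yGen (c : ℕ) : coproduct R (yGen s t c) =
    yGen s t c ⊗ₜ[R] 1 + 1 ⊗ₜ[R] yGen s t c +
      (s + t) • ∑ p ∈ antidiagonal c, yGen s t p.1 ⊗ₜ[R] yGen s t p.2 +
      (s * t) • ∑ q ∈ antidiagonal c, (∑ p ∈ antidiagonal q.1, yGen s t p.1 ⊗ₜ[R] yGen s t p.2) *
        coproduct R (yGen s t q.2) := by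
  have hv := constantCoeff_leftSeries R
  have hw := constantCoeff_rightSeries R
  obtain ⟨hcomm, hlog⟩ := compose_log_add_of_commute (R := R) hv hw
    (commute_leftSeries_rightSeries R)
  -- The roles of s and t are exchanged, since the functional equation of f is stated with t - s; α
  -- and β are symmetric.
  have hf := compose_add_of_commute (s := t) (t := s) (eulerianSeries_eq s t)
    (constantCoeff_compose (PowerSeries.constantCoeff_log (A := R)) (leftSeries R))
    (constantCoeff_compose (PowerSeries.constantCoeff_log (A := R)) (rightSeries R)) hcomm
  rw [← hlog, ← map_coproduct_sigma_sub_one, leftSeries, rightSeries, ← map_compose, ← map_compose,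
    ← map_compose, ← map_compose, ← map_compose, ← map_compose] at hf
  change PowerSeries.map _ (ySeries s t) = PowerSeries.map _ (ySeries s t) +
    PowerSeries.map _ (ySeries s t) + (t + s) • (PowerSeries.map _ (ySeries s t) *
      PowerSeries.map _ (ySeries s t)) + (t * s) • (PowerSeries.map _ (ySeries s t) *
      PowerSeries.map _ (ySeries s t) * PowerSeries.map _ (ySeries s t)) at hf
  have h := congrArg (PowerSeries.coeff c) hf
  simp only [map_add, PowerSeries.coeff_smul, PowerSeries.coeff_mul, PowerSeries.coeff_map,
    coeff_ySeries, RingHom.coe_coe, Algebra.TensorProduct.includeLeft_apply,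
    Algebra.TensorProduct.includeRight_apply, Algebra.TensorProduct.tmul_mul_tmul, mul_one,
    one_mul] at h
  rw [h, add_comm t s, mul_comm t s]

/-- The coordinate of `Y^I ⊗ Y^J`. -/
def yCoord (I J : List ℕ+) : NSym R ⊗[R] NSym R →ₗ[R] R :=
  tensorFunctional ((yBasis s t).coord I) ((yBasis s t).coord J)

theorem yBasis_coord_cons_yGen_mul (a : ℕ+) (u : List ℕ+) (i : ℕ) (x : NSym R) :
    (yBasis s t).coord (a :: u) (yGen s t i * x) =
      if (a : ℕ) = i then (yBasis s t).coord u x else 0 := by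
  rcases Nat.eq_zero_or_pos i with rfl | hi
  · rw [yGen_zero, zero_mul, map_zero, if_neg a.ne_zero]
  · lift i to ℕ+ using hi
    simp only [Module.Basis.coord_apply, yBasis_repr_yGen_mul_cons, PNat.coe_inj]

theorem yBasis_coord_nil_yGen_mul (i : ℕ) (x : NSym R) :
    (yBasis s t).coord [] (yGen s t i * x) = 0 := by
  rcases Nat.eq_zero_or_pos i with rfl | hi
  · rw [yGen_zero, zero_mul, map_zero]
  · lift i to ℕ+ using hi
    rw [Module.Basis.coord_apply, yBasis_repr_yGen_mul_nil]

theorem yCoord_nil_left (J : List ℕ+) (i : ℕ) (y : NSym R) (x : NSym R ⊗[R] NSym R) :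
    yCoord s t [] J ((yGen s t i ⊗ₜ[R] y) * x) = 0 := by
  induction x using TensorProduct.induction_on with
  | zero => rw [mul_zero, map_zero]
  | tmul x x' =>
    rw [Algebra.TensorProduct.tmul_mul_tmul, yCoord, tensorFunctional_tmul,
      yBasis_coord_nil_yGen_mul, zero_mul]
  | add x x' hx hx' => rw [mul_add, map_add, hx, hx', add_zero]

theorem yCoord_nil_right (I : List ℕ+) (i : ℕ) (y : NSym R) (x : NSym R ⊗[R] NSym R) :
    yCoord s t I [] ((y ⊗ₜ[R] yGen s t i) * x) = 0 := by
  induction x using TensorProduct.induction_on with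
  | zero => rw [mul_zero, map_zero]
  | tmul x x' =>
    rw [Algebra.TensorProduct.tmul_mul_tmul, yCoord, tensorFunctional_tmul,
      yBasis_coord_nil_yGen_mul, mul_zero]
  | add x x' hx hx' => rw [mul_add, map_add, hx, hx', add_zero]

theorem yCoord_cons_left (a : ℕ+) (u J : List ℕ+) (i : ℕ) (x : NSym R ⊗[R] NSym R) :
    yCoord s t (a :: u) J ((yGen s t i ⊗ₜ[R] 1) * x) =
      if (a : ℕ) = i then yCoord s t u J x else 0 := by
  induction x using TensorProduct.induction_on with
  | zero => simp
  | tmul x x' =>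
    rw [Algebra.TensorProduct.tmul_mul_tmul, yCoord, yCoord, tensorFunctional_tmul,
      tensorFunctional_tmul, yBasis_coord_cons_yGen_mul, one_mul, ite_mul, zero_mul]
  | add x x' hx hx' =>
    rw [mul_add, map_add, hx, hx', map_add]
    split_ifs <;> simp

theorem yCoord_cons_right (b : ℕ+) (I v : List ℕ+) (i : ℕ) (x : NSym R ⊗[R] NSym R) :
    yCoord s t I (b :: v) ((1 ⊗ₜ[R] yGen s t i) * x) =
      if (b : ℕ) = i then yCoord s t I v x else 0 := by
  induction x using TensorProduct.induction_on with
  | zero => simp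
  | tmul x x' =>
    rw [Algebra.TensorProduct.tmul_mul_tmul, yCoord, yCoord, tensorFunctional_tmul,
      tensorFunctional_tmul, yBasis_coord_cons_yGen_mul, one_mul, mul_ite, mul_zero]
  | add x x' hx hx' =>
    rw [mul_add, map_add, hx, hx', map_add]
    split_ifs <;> simp

theorem yCoord_cons_cons (a b : ℕ+) (u v : List ℕ+) (c : ℕ) (x : NSym R ⊗[R] NSym R) :
    yCoord s t (a :: u) (b :: v)
        ((∑ p ∈ antidiagonal c, yGen s t p.1 ⊗ₜ[R] yGen s t p.2) * x) =
      if (a : ℕ) + b = c then yCoord s t u v x else 0 := by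
  have h : ∀ p : ℕ × ℕ, yCoord s t (a :: u) (b :: v) ((yGen s t p.1 ⊗ₜ[R] yGen s t p.2) * x) =
      if ((a : ℕ), (b : ℕ)) = p then yCoord s t u v x else 0 := fun p => by
    have : yGen s t p.1 ⊗ₜ[R] yGen s t p.2 = (yGen s t p.1 ⊗ₜ[R] 1) * (1 ⊗ₜ[R] yGen s t p.2) := by
      simp
    rw [this, mul_assoc, yCoord_cons_left, yCoord_cons_right]
    simp only [Prod.ext_iff, ite_and]
  rw [Finset.sum_mul, map_sum, Finset.sum_congr rfl fun p _ => h p, Finset.sum_ite_eq]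
  simp only [Finset.HasAntidiagonal.mem_antidiagonal]

/-- Taking coefficients in the formula for ΔY_c times ΔY^K reproduces the recursion of ⋆ term by
term. The induction is on weight, not length: the β-term replaces cK by (c-a-b)K, a word equally
long but lighter. -/
theorem yCoord_coproduct_yMul (K : List ℕ+) : ∀ I J : List ℕ+,
    yCoord s t I J (coproduct R (yMul s t K)) = deformedShuffle (s + t) (s * t) I J K := by
  classical
  induction hn : weight K using Nat.strong_induction_on generalizing K with
  | _ n ih =>
    subst hn
    intro I J
    rcases K with _ | ⟨c, K⟩
    · have h1 : coproduct R (yMul s t []) = yMul s t [] ⊗ₜ[R] yMul s t [] := by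
        rw [yMul_nil, map_one, Algebra.TensorProduct.one_def]
      rw [h1, yCoord, tensorFunctional_tmul, ← yBasis_apply, Module.Basis.coord_apply,
        Module.Basis.coord_apply, Module.Basis.repr_self, Finsupp.single_apply,
        Finsupp.single_apply]
      rcases I with _ | ⟨a, u⟩
      · rw [deformedShuffle, Finsupp.single_apply]
        simp [eq_comm]
      · rcases J with _ | ⟨b, v⟩
        · rw [deformedShuffle, Finsupp.single_apply]
          simp
        · rw [deformedShuffle]
          simp [prepend_apply_nil, zeta_apply_nil]
    · have hK : weight K < weight (c :: K) := by
        rw [weight_cons]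
        have := c.pos
        omega
      have hnil : ∀ (i : ℕ) (x : NSym R ⊗[R] NSym R) (J : List ℕ+), yCoord s t [] J
          ((∑ p ∈ antidiagonal i, yGen s t p.1 ⊗ₜ[R] yGen s t p.2) * x) = 0 := fun i x J => by
        rw [Finset.sum_mul, map_sum]
        exact Finset.sum_eq_zero fun p _ => yCoord_nil_left s t _ _ _ _
      have hnil' : ∀ (i : ℕ) (x : NSym R ⊗[R] NSym R) (I : List ℕ+), yCoord s t I []
          ((∑ p ∈ antidiagonal i, yGen s t p.1 ⊗ₜ[R] yGen s t p.2) * x) = 0 := fun i x I => by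
        rw [Finset.sum_mul, map_sum]
        exact Finset.sum_eq_zero fun p _ => yCoord_nil_right s t _ _ _ _
      have hsum : yCoord s t I J ((∑ q ∈ antidiagonal (c : ℕ),
            (∑ p ∈ antidiagonal q.1, yGen s t p.1 ⊗ₜ[R] yGen s t p.2) *
              coproduct R (yGen s t q.2)) * coproduct R (yMul s t K)) =
          ∑ q ∈ antidiagonal (c : ℕ), yCoord s t I J
            ((∑ p ∈ antidiagonal q.1, yGen s t p.1 ⊗ₜ[R] yGen s t p.2) *
              (coproduct R (yGen s t q.2) * coproduct R (yMul s t K))) := by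
        rw [Finset.sum_mul, map_sum]
        exact Finset.sum_congr rfl fun q _ => by rw [mul_assoc]
      rw [yMul_cons, map_mul, coproduct_yGen, add_mul, add_mul, add_mul, map_add, map_add, map_add,
        smul_mul_assoc, smul_mul_assoc, map_smul, map_smul, hsum]
      rcases I with _ | ⟨a, u⟩
      · simp only [hnil, yCoord_nil_left, Finset.sum_const_zero, smul_zero, add_zero, zero_add]
        rw [deformedShuffle]
        rcases J with _ | ⟨b, v⟩
        · rw [yCoord_nil_right, Finsupp.single_apply, if_neg (by simp)]
        · rw [yCoord_cons_right, ih _ hK _ rfl, deformedShuffle, Finsupp.single_apply,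
            Finsupp.single_apply]
          by_cases h : b = c <;> simp [h]
      · rcases J with _ | ⟨b, v⟩
        · simp only [hnil', yCoord_nil_right, Finset.sum_const_zero, smul_zero, add_zero]
          rw [yCoord_cons_left, ih _ hK _ rfl, deformedShuffle, Finsupp.single_apply]
          have hu : deformedShuffle (s + t) (s * t) u [] = Finsupp.single u 1 := by
            cases u <;> rw [deformedShuffle]
          rw [hu, Finsupp.single_apply]
          by_cases h : a = c <;> simp [h]
        · rw [yCoord_cons_left, yCoord_cons_right, yCoord_cons_cons]
          simp only [yCoord_cons_cons, ih _ hK _ rfl]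
          rw [deformedShuffle]
          simp only [Finsupp.add_apply, Finsupp.smul_apply, prepend_apply_cons, zeta_apply_cons,
            smul_eq_mul, ← PNat.coe_inj, ← PNat.coe_lt_coe, PNat.add_coe]
          congr 2
          rw [Finset.Nat.sum_antidiagonal_eq_sum_range_succ_mk, Finset.sum_ite_eq]
          -- Only the ζ-term is left, and only the index a+b can contribute. If a+b < c the
          -- remaining factors form Y^{(c-a-b)K}; if a+b = c the factor Y_0 = 0 kills the term; if
          -- a+b > c the index does not occur.
          rcases lt_trichotomy ((a : ℕ) + b) c with h | h | h
          · have hx : a + b < c := h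
            have hd : ((c - (a + b) : ℕ+) : ℕ) = c - (a + b) := by
              rw [PNat.sub_coe, if_pos hx, PNat.add_coe]
            rw [if_pos (Finset.mem_range.2 (by omega)), if_pos h, ← hd, ← map_mul, ← yMul_cons,
              ih _ _ _ rfl]
            rw [weight_cons, weight_cons, hd]
            have := a.pos
            omega
          · rw [if_pos (Finset.mem_range.2 (by omega)), if_neg (by omega), h, Nat.sub_self,
              yGen_zero, map_zero, zero_mul, map_zero]
          · rw [if_neg (by rw [Finset.mem_range]; omega), if_neg (by omega)]

/-- The coordinate of the product at X_K is its pairing with Y^K, hence the coefficient of Y^I ⊗ Y^J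
in ΔY^K. -/
theorem xBasis_mul (I J : List ℕ+) : xBasis s t I * xBasis s t J =
    Finsupp.linearCombination R (xBasis s t) (deformedShuffle (s + t) (s * t) I J) := by
  refine (xBasis s t).repr.injective (Finsupp.ext fun K => ?_)
  rw [Module.Basis.repr_linearCombination, xBasis_repr_apply, pairing_mul, pairing_xBasis,
    pairing_xBasis]
  exact yCoord_coproduct_yMul s t K I J

theorem linearCombination_xBasis_starMul (p q : Words R) :
    Finsupp.linearCombination R (xBasis s t) (starMul (s + t) (s * t) p q) =
      Finsupp.linearCombination R (xBasis s t) p * Finsupp.linearCombination R (xBasis s t) q := by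
  rw [starMul, Finsupp.linearCombination_apply R p, Finsupp.linearCombination_apply R q,
    Finsupp.sum, Finsupp.sum, Finsupp.sum, map_sum, Finset.sum_mul_sum]
  refine Finset.sum_congr rfl fun u _ => ?_
  rw [Finsupp.sum, map_sum]
  refine Finset.sum_congr rfl fun v _ => ?_
  rw [map_smul, ← xBasis_mul, smul_mul_smul_comm]

theorem linearCombination_xBasis_injective :
    Function.Injective (Finsupp.linearCombination R (xBasis s t)) :=
  (xBasis s t).linearIndependent

end Coproduct

/-! ### Special cases of the deformed quasi-shuffle -/

section Special

variable {R : Type*} [CommRing R]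

theorem deformedShuffle_zero_zero : deformedShuffle (0 : R) 0 = shuffle R := by
  funext u v
  induction u, v using shuffle.induct with
  | case1 w => rw [deformedShuffle, shuffle]
  | case2 a u => rw [deformedShuffle, shuffle]
  | case3 a u b v h1 h2 => rw [deformedShuffle, shuffle, h1, h2, zero_smul, zero_smul, add_zero,
      add_zero]

theorem deformedShuffle_one_zero : deformedShuffle (1 : R) 0 = quasiShuffle R := by
  funext u v
  induction u, v using quasiShuffle.induct with
  | case1 w => rw [deformedShuffle, quasiShuffle]
  | case2 a u => rw [deformedShuffle, quasiShuffle]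
  | case3 a u b v h1 h2 h3 => rw [deformedShuffle, quasiShuffle, h1, h2, h3, one_smul, zero_smul,
      add_zero]

theorem deformedShuffle_zero_neg_one : deformedShuffle (0 : R) (-1) = blockShuffle R := by
  funext u v
  induction u, v using blockShuffle.induct with
  | case1 w => rw [deformedShuffle, blockShuffle]
  | case2 a u => rw [deformedShuffle, blockShuffle]
  | case3 a u b v h1 h2 h3 => rw [deformedShuffle, blockShuffle, h1, h2, h3, zero_smul, add_zero,
      neg_smul, one_smul, sub_eq_add_neg]

end Special

end

end EulerianQSym

open EulerianQSym
theorem mainTheorem1 {R : Type*} [CommRing R] [Algebra ℚ R] (s t : R) :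
    -- `f = (e^{sx} - e^{tx}) / (s e^{tx} - t e^{sx})`, with the denominator cleared
    eulerianSeries s t *
        (PowerSeries.C s * PowerSeries.rescale t (PowerSeries.exp R)
          - PowerSeries.C t * PowerSeries.rescale s (PowerSeries.exp R))
      = PowerSeries.rescale s (PowerSeries.exp R) - PowerSeries.rescale t (PowerSeries.exp R) ∧
    -- `Y^I` is a basis of the algebra of noncommutative symmetric functions
    (∃ Y : Module.Basis (List ℕ+) R (NSym R), ∀ I, Y I = yMul s t I) ∧
    -- there is exactly one family `X_I` dual to `Y^I`, it is a basis, and `X_I X_J = X(I ⋆ J)`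
    (∃ X : Module.Basis (List ℕ+) R (QSym R),
      IsDualFamily X (yMul s t) ∧
      (∀ X' : List ℕ+ → QSym R, IsDualFamily X' (yMul s t) → X' = X) ∧
      ∀ I J : List ℕ+,
        X I * X J = Finsupp.linearCombination R X (deformedShuffle (s + t) (s * t) I J)) ∧
    -- `⋆` is commutative and associative
    (∀ p q : Words R, starMul (s + t) (s * t) p q = starMul (s + t) (s * t) q p) ∧
    (∀ p q r : Words R,
      starMul (s + t) (s * t) (starMul (s + t) (s * t) p q) r
        = starMul (s + t) (s * t) p (starMul (s + t) (s * t) q r)) ∧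
    -- `s = t = 0`: `f = x` and `⋆` is the shuffle
    (eulerianSeries (0 : R) 0 = PowerSeries.X ∧
      deformedShuffle ((0 : R) + 0) (0 * 0) = shuffle R) ∧
    -- `s = 1`, `t = 0`: `f = e^x - 1` and `⋆` is the quasi-shuffle
    (eulerianSeries (1 : R) 0 = PowerSeries.exp R - 1 ∧
      deformedShuffle ((1 : R) + 0) (1 * 0) = quasiShuffle R) ∧
    -- `s = 1`, `t = -1`: `f = tanh x` and `⋆` is the block shuffle
    (eulerianSeries (1 : R) (-1) *
          (PowerSeries.exp R + PowerSeries.rescale (-1) (PowerSeries.exp R))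
        = PowerSeries.exp R - PowerSeries.rescale (-1) (PowerSeries.exp R) ∧
      deformedShuffle ((1 : R) + -1) (1 * -1) = blockShuffle R) := by
  refine ⟨eulerianSeries_mul s t, ⟨yBasis s t, yBasis_apply s t⟩,
    ⟨xBasis s t, isDualFamily_xBasis s t, fun X' hX' => eq_xBasis_of_isDualFamily s t hX',
      xBasis_mul s t⟩, fun p q => ?_, fun p q r => ?_,
    ⟨eulerianSeries_zero_zero, ?_⟩, ⟨eulerianSeries_one_zero, ?_⟩,
    ⟨eulerianSeries_one_neg_one, ?_⟩⟩
  -- X is injective and turns ⋆ into the commutative, associative product of quasi-symmetric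
  -- functions.
  · refine linearCombination_xBasis_injective s t ?_
    rw [linearCombination_xBasis_starMul, linearCombination_xBasis_starMul, mul_comm]
  · refine linearCombination_xBasis_injective s t ?_
    simp only [linearCombination_xBasis_starMul, mul_assoc]
  · rw [add_zero, mul_zero, deformedShuffle_zero_zero]
  · rw [add_zero, mul_zero, deformedShuffle_one_zero]
  · rw [add_neg_cancel, one_mul, deformedShuffle_zero_neg_one]
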